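/- **Setting.** Let $K\in\mathbb N=\{1,2,\dots\}$ and let $X_k=\{X_k(n):n\in\mathbb N\}$, $k\in[K]=\{1,\dots,K\}$, be independent data streams. For each $k$ let $\mathrm P_k^0,\mathrm P_k^1$ be two probability laws for $X_k$; stream $k$ is *noise* if its law is $\mathrm P_k^0$ and a *signal* if its law is $\mathrm P_k^1$. For $A\subseteq[K]$ let $\mathrm P_A$ be the product law under which exactly the streams in $A$ are signals, and $\mathrm E_A$ the expectation under $\mathrm P_A$. Put $\mathcal F_k(n)=\sigma(X_k(1),\dots,X_k(n))$ and $\mathcal F(n)=\sigma(\mathcal F_1(n),\dots,\mathcal F_K(n))$. **Procedures.** A sequential multiple testing procedure $\chi=(T_k,D_k)_{k\in[K]}$ consists of random times $T_k\in\mathbb N\cup\{\infty\}$ and $\{0,1\}$-valued random variables $D_k$ ($D_k=1$ means that stream $k$ is declared a signal) such that $\{T_k=n\},\{T_k=n,D_k=i\}\in\mathcal F(n)$ for all $k\in[K]$, $n\in\mathbb N$, $i\in\{0,1\}$. It is *decentralized* if these events belong to $\mathcal F_k(n)$. For integers $0\le l\le u\le K$ with $u>0$ and $l<K$, let $\Pi_{l,u}=\{A\subseteq[K]:l\le|A|\le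 u\}$. For $\alpha,\beta\in(0,1)$ let $\Delta(\alpha,\beta)$ be the set of procedures such that, for every $A\in\Pi_{l,u}$, $\mathrm P_A(T_k<\infty)=1$ for all $k\in[K]$, $\mathrm P_A(\exists j\notin A: D_j=1)\le\alpha$ and $\mathrm P_A(\exists i\in A: D_i=0)\le\beta$. Let $\mathcal L_{k,A}(\alpha,\beta)$ (resp. $\mathcal L'_{k,A}(\alpha,\beta)$) be the infimum of $\mathrm E_A[T_k]$ over all (resp. all decentralized) procedures in $\Delta(\alpha,\beta)$. The asymptotic relative efficiency of decentralized procedures versus the general family is $$\operatorname{ARE}'_{k,A}(l,u)=\lim_{\alpha,\beta\to0}\frac{\mathcal L_{k,A}(\alpha,\beta)}{\mathcal L'_{k,A}(\alpha,\beta)},$$ where $\alpha$ and $\beta$ tend to $0$ from above, jointly and without any relation between them. **Assumptions.** For every $k\in[K]$ and $n\in\mathbb N$, $\mathrm P_k^1$ and $\mathrm P_k^0$ are mutually absolutely continuous on $\mathcal F_k(n)$; let $\lambda_k(n)=\log\frac{d\mathrm P_k^1}{d\mathrm P_k^0}(\mathcal F_k(n))$. For every $k\in[K]$ there are numbers $I_k,J_k>0$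 with $$\mathrm P_k^1\Big(\limsup_{n\to\infty}\tfrac{\lambda_k(n)}n\le I_k\Big)=1,\qquad \mathrm P_k^0\Big(\limsup_{n\to\infty}\tfrac{-\lambda_k(n)}n\le J_k\Big)=1,$$ and, for every $\epsilon>0$, $$\sum_{n=1}^\infty\mathrm P_k^1\Big(\tfrac{\lambda_k(n)}n\le I_k-\epsilon\Big)<\infty,\qquad \sum_{n=1}^\infty\mathrm P_k^0\Big(\tfrac{-\lambda_k(n)}n\le J_k-\epsilon\Big)<\infty.$$ **Claim.** Let $A\in\Pi_{l,u}$, and put $\mathcal I_A=\min_{i\in A}I_i$ and $\mathcal J_A=\min_{j\notin A}J_j$. Then, for every $i\in A$ and every $j\notin A$, the limits defining $\operatorname{ARE}'_{i,A}(l,u)$ and $\operatorname{ARE}'_{j,A}(l,u)$ exist and $$\operatorname{ARE}'_{i,A}(l,u)=\begin{cases}\dfrac{I_i}{I_i+\mathcal J_A}&\text{if }|A|=l,\\[1ex]1&\text{otherwise,}\end{cases}\qquad \operatorname{ARE}'_{j,A}(l,u)=\begin{cases}\dfrac{J_j}{J_j+\mathcal I_A}&\text{if }|A|=u,\\[1ex]1&\text{otherwise.}\end{cases}$$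 In particular, if $l=0$ then $\operatorname{ARE}'_{i,A}(l,u)=1$ for all $i\in A$, and if $u=K$ then $\operatorname{ARE}'_{j,A}(l,u)=1$ for all $j\notin A$. -/

import Mathlib

open MeasureTheory Filter Topology
open scoped ENNReal

namespace SeqTest

noncomputable section

/-- The `σ`-algebra generated by the first `n` observations of one stream.  A path is a sequence
`x : ℕ → S`, where `x t` is the observation made at time `t + 1`. -/
abbrev pathSigma (S : Type*) [MeasurableSpace S] (n : ℕ) : MeasurableSpace (ℕ → S) :=
  cylinderEvents (Set.Iio n)

/-- The restriction of the law `P` of one stream to its first `n` observations. -/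
def restr {S : Type*} [MeasurableSpace S] (P : Measure (ℕ → S)) (n : ℕ) :
    @Measure (ℕ → S) (pathSigma S n) :=
  P.trim cylinderEvents_le_pi

/-- The log-likelihood ratio of `P₁` versus `P₀` based on the first `n` observations. -/
def logLR {S : Type*} [MeasurableSpace S] (P₀ P₁ : Measure (ℕ → S)) (n : ℕ) (x : ℕ → S) : ℝ :=
  llr (restr P₁ n) (restr P₀ n) x

/-- The distributional assumptions on one stream, with law `P₀` under the null and `P₁` under the
alternative hypothesis, and with rates `I` (under `P₁`) and `J` (under `P₀`). -/
structure StreamAssumptions {S : Type*} [MeasurableSpace S] (P₀ P₁ : Measure (ℕ → S))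
    (I J : ℝ) : Prop where
  I_pos : 0 < I
  J_pos : 0 < J
  /-- The two laws are mutually absolutely continuous on every finite horizon. -/
  ac₁ : ∀ n, restr P₁ n ≪ restr P₀ n
  ac₀ : ∀ n, restr P₀ n ≪ restr P₁ n
  /-- Almost sure upper bounds on the growth of the log-likelihood ratio. -/
  limsup₁ : ∀ᵐ x ∂P₁, limsup (fun n : ℕ => ((logLR P₀ P₁ n x / n : ℝ) : EReal)) atTop ≤ (I : EReal)
  limsup₀ : ∀ᵐ x ∂P₀, limsup (fun n : ℕ => ((-logLR P₀ P₁ n x / n : ℝ) : EReal)) atTop ≤ (J : EReal)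
  /-- One-sided complete convergence; the sums run over the times `n + 1 ≥ 1`. -/
  complete₁ : ∀ ε : ℝ, 0 < ε →
    ∑' n : ℕ, P₁ {x | logLR P₀ P₁ (n + 1) x / (n + 1 : ℕ) ≤ I - ε} < ∞
  complete₀ : ∀ ε : ℝ, 0 < ε →
    ∑' n : ℕ, P₀ {x | -logLR P₀ P₁ (n + 1) x / (n + 1 : ℕ) ≤ J - ε} < ∞

variable {K : ℕ} {S : Fin K → Type*} [∀ k, MeasurableSpace (S k)]

/-- The information of stream `k` alone up to time `n`, on the joint path space. -/
abbrev localSigma (S : Fin K → Type*) [∀ k, MeasurableSpace (S k)] (k : Fin K) (n : ℕ) :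
    MeasurableSpace (∀ k, ℕ → S k) :=
  (pathSigma (S k) n).comap (fun ω => ω k)

/-- The information of all streams up to time `n`. -/
abbrev globalSigma (S : Fin K → Type*) [∀ k, MeasurableSpace (S k)] (n : ℕ) :
    MeasurableSpace (∀ k, ℕ → S k) :=
  ⨆ k, localSigma S k n

/-- The joint law when `A` is the set of signals: the streams are independent, those in `A`
follow `P₁`, the others follow `P₀`. -/
def jointLaw (P₀ P₁ : ∀ k, Measure (ℕ → S k)) (A : Finset (Fin K)) : Measure (∀ k, ℕ → S k) :=
  Measure.pi (fun k => if k ∈ A then P₁ k else P₀ k)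

/-- `T` is a stopping time with values in `{1, 2, …} ∪ {∞}` with respect to `F`, and `D` is a
binary random variable that is determined by the information available at time `T`. -/
structure IsDecision {Ω : Type*} [MeasurableSpace Ω] (F : ℕ → MeasurableSpace Ω)
    (T : Ω → ℕ∞) (D : Ω → Bool) : Prop where
  one_le : ∀ ω, 1 ≤ T ω
  measurable_D : Measurable D
  time : ∀ n : ℕ, MeasurableSet[F n] {ω | T ω = n}
  decision : ∀ (n : ℕ) (i : Bool), MeasurableSet[F n] {ω | T ω = n ∧ D ω = i}

/-- A sequential multiple testing procedure: decision times `T k` and decisions `D k`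
(`true` means that stream `k` is identified as a signal), based on the data of all streams. -/
structure Procedure (S : Fin K → Type*) [∀ k, MeasurableSpace (S k)] where
  T : Fin K → (∀ k, ℕ → S k) → ℕ∞
  D : Fin K → (∀ k, ℕ → S k) → Bool
  isDecision : ∀ k, IsDecision (globalSigma S) (T k) (D k)

/-- In a decentralized procedure, each decision uses only the data of its own stream. -/
def Procedure.Decentralized (χ : Procedure S) : Prop :=
  ∀ k, IsDecision (localSigma S k) (χ.T k) (χ.D k)

/-- Type-I familywise error rate when `A` is the set of signals. -/
def Procedure.fwe₁ (χ : Procedure S) (P₀ P₁ : ∀ k, Measure (ℕ → S k)) (A : Finset (Fin K)) :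
    ℝ≥0∞ :=
  jointLaw P₀ P₁ A {ω | ∃ j, j ∉ A ∧ χ.D j ω = true}

/-- Type-II familywise error rate when `A` is the set of signals. -/
def Procedure.fwe₂ (χ : Procedure S) (P₀ P₁ : ∀ k, Measure (ℕ → S k)) (A : Finset (Fin K)) :
    ℝ≥0∞ :=
  jointLaw P₀ P₁ A {ω | ∃ i, i ∈ A ∧ χ.D i ω = false}

/-- The sets of signals with at least `l` and at most `u` elements. -/
def boundedClass (K l u : ℕ) : Set (Finset (Fin K)) := {A | l ≤ A.card ∧ A.card ≤ u}

/-- The procedures that, for every set of signals in `Pr`, terminate almost surely in every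
stream and have familywise error rates at most `α` and `β`. -/
def controlled (P₀ P₁ : ∀ k, Measure (ℕ → S k)) (Pr : Set (Finset (Fin K))) (α β : ℝ) :
    Set (Procedure S) :=
  {χ | ∀ A ∈ Pr, (∀ k, ∀ᵐ ω ∂(jointLaw P₀ P₁ A), χ.T k ω < ⊤) ∧
    χ.fwe₁ P₀ P₁ A ≤ ENNReal.ofReal α ∧ χ.fwe₂ P₀ P₁ A ≤ ENNReal.ofReal β}

/-- The expected decision time in stream `k` when `A` is the set of signals. -/
def Procedure.expTime (χ : Procedure S) (P₀ P₁ : ∀ k, Measure (ℕ → S k)) (k : Fin K)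
    (A : Finset (Fin K)) : ℝ≥0∞ :=
  ∫⁻ ω, (χ.T k ω : ℝ≥0∞) ∂(jointLaw P₀ P₁ A)

/-- The optimal expected decision time in stream `k` among all procedures. -/
def optTime (P₀ P₁ : ∀ k, Measure (ℕ → S k)) (Pr : Set (Finset (Fin K))) (k : Fin K)
    (A : Finset (Fin K)) (α β : ℝ) : ℝ≥0∞ :=
  ⨅ χ ∈ controlled P₀ P₁ Pr α β, χ.expTime P₀ P₁ k A

/-- The optimal expected decision time in stream `k` among decentralized procedures. -/
def optTimeDec (P₀ P₁ : ∀ k, Measure (ℕ → S k)) (Pr : Set (Finset (Fin K))) (k : Fin K)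
    (A : Finset (Fin K)) (α β : ℝ) : ℝ≥0∞ :=
  ⨅ χ ∈ {χ : Procedure S | χ.Decentralized} ∩ controlled P₀ P₁ Pr α β, χ.expTime P₀ P₁ k A

/-- The asymptotic relative efficiency of decentralized procedures in stream `k`, when `A` is the
set of signals and the number of signals is known to be between `l` and `u`, exists and is `r`:
the ratio of the two optimal expected decision times tends to `r` as `α, β → 0` jointly. -/
def HasAREDec (P₀ P₁ : ∀ k, Measure (ℕ → S k)) (l u : ℕ) (k : Fin K) (A : Finset (Fin K))
    (r : ℝ≥0∞) : Prop :=
  Tendsto (fun p : ℝ × ℝ => optTime P₀ P₁ (boundedClass K l u) k A p.1 p.2 /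
      optTimeDec P₀ P₁ (boundedClass K l u) k A p.1 p.2)
    (𝓝[>] 0 ×ˢ 𝓝[>] 0) (𝓝 r)

/-- The minimum of the numbers `r k`, `k ∈ B`; it is `∞` when `B` is empty. -/
def minRate (r : Fin K → ℝ) (B : Finset (Fin K)) : ℝ≥0∞ := B.inf (fun k => ENNReal.ofReal (r k))

end

end SeqTest

/-! For a signal `i`, write `x = -log α`. Both optimal times turn out to be asymptotic to `x / R`,
whatever `β` does, so the efficiency is the quotient of two rates `R`.

Lower bounds come from a change of measure (`eventually_le_lintegral_decision`). Under a set `B` of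
the class with `i ∉ B`, declaring `i` a signal has probability at most `α`. A procedure that usually
declares it under `A` must therefore wait until the log-likelihood ratio of `A` versus `B` is about
`x`, and `R` is the growth rate of that ratio. If `|A| > l`, then `B = A \ {i}` gives `R = I i`. If
`|A| = l`, that set is too small, and exchanging `i` for the noise stream `j₀` with the least `J`
gives `R = I i + J j₀`. A decentralized procedure sees only stream `i`, so any `B` of the class
omitting `i` gives `R = I i`.

Upper bounds come from explicit stopping rules. Parallel sequential probability ratio tests attain
`I i` (`exists_optTimeDec_le`). If `|A| = l`, the rule also declares `k` a signal once its
log-likelihood ratio exceeds those of `K - l` other streams by the threshold (`exists_optTime_le`).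
If `k` is noise, at most `K - l - 1` of the others are noise, so a false alarm requires a large gap
over a true signal, which Ville's inequality (`jointLaw_iUnion_le`) makes unlikely. Under `A` itself
the relevant gaps are those over `Aᶜ`, and they grow at rate at least `I i + J j₀`.

Noise streams follow by symmetry (`HasAREDec.swap`): exchange the two hypotheses, complement the
signal set, negate the decisions and exchange `α` with `β`. -/

namespace SeqTest

/-! ### Likelihood ratios of a single stream -/

section OneStream

variable {S : Type*} [MeasurableSpace S]

lemma measurable_logLR_pathSigma (P₀ P₁ : Measure (ℕ → S)) (n : ℕ) :
    Measurable[pathSigma S n] (logLR P₀ P₁ n) :=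
  @measurable_llr _ (pathSigma S n) (restr P₁ n) (restr P₀ n)

lemma measurable_logLR (P₀ P₁ : Measure (ℕ → S)) (n : ℕ) : Measurable (logLR P₀ P₁ n) :=
  (measurable_logLR_pathSigma P₀ P₁ n).mono cylinderEvents_le_pi le_rfl

lemma pathSigma_mono {m n : ℕ} (h : m ≤ n) : pathSigma S m ≤ pathSigma S n :=
  cylinderEvents_mono (Set.Iio_subset_Iio h)

/-- Absolute continuity of `P₀` with respect to `P₁` makes the density positive `P₀`-almost
everywhere. Without it, `Real.log 0 = 0` would turn a vanishing density into `1`. -/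
lemma exp_logLR_ae {P₀ P₁ : Measure (ℕ → S)} [IsProbabilityMeasure P₀] [IsProbabilityMeasure P₁]
    {n : ℕ} (h₀ : restr P₀ n ≪ restr P₁ n) :
    (fun x => ENNReal.ofReal (Real.exp (logLR P₀ P₁ n x)))
      =ᵐ[restr P₀ n] (restr P₁ n).rnDeriv (restr P₀ n) := by
  have : IsFiniteMeasure (restr P₀ n) := by unfold restr; infer_instance
  have : IsFiniteMeasure (restr P₁ n) := by unfold restr; infer_instance
  filter_upwards [exp_llr_of_ac' (restr P₁ n) (restr P₀ n) h₀,
    Measure.rnDeriv_lt_top (restr P₁ n) (restr P₀ n)] with x hx hx'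
  rw [logLR, hx, ENNReal.ofReal_toReal hx'.ne]

/-- On the first `n` observations, `P₁` has density `exp (logLR P₀ P₁ n)` with respect to `P₀`. -/
lemma measure_eq_setLIntegral_exp_logLR {P₀ P₁ : Measure (ℕ → S)} [IsProbabilityMeasure P₀]
    [IsProbabilityMeasure P₁] {n : ℕ} (h₁ : restr P₁ n ≪ restr P₀ n)
    (h₀ : restr P₀ n ≪ restr P₁ n) {E : Set (ℕ → S)} (hE : MeasurableSet[pathSigma S n] E) :
    P₁ E = ∫⁻ x in E, ENNReal.ofReal (Real.exp (logLR P₀ P₁ n x)) ∂P₀ := by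
  have : IsFiniteMeasure (restr P₀ n) := by unfold restr; infer_instance
  have : IsFiniteMeasure (restr P₁ n) := by unfold restr; infer_instance
  have hm : pathSigma S n ≤ MeasurableSpace.pi := cylinderEvents_le_pi
  rw [← setLIntegral_trim hm
    ((measurable_logLR_pathSigma P₀ P₁ n).exp.ennreal_ofReal) hE]
  change _ = ∫⁻ x in E, _ ∂(restr P₀ n)
  rw [setLIntegral_congr_fun_ae hE ((exp_logLR_ae h₀).mono fun x hx _ => hx),
    Measure.setLIntegral_rnDeriv h₁ E]
  exact (trim_measurableSet_eq hm hE).symm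

lemma logLR_swap_ae {P₀ P₁ : Measure (ℕ → S)} [IsProbabilityMeasure P₀]
    [IsProbabilityMeasure P₁] {n : ℕ} (h₁ : restr P₁ n ≪ restr P₀ n) :
    ∀ᵐ x ∂P₁, logLR P₁ P₀ n x = -logLR P₀ P₁ n x := by
  have : IsFiniteMeasure (restr P₀ n) := by unfold restr; infer_instance
  have : IsFiniteMeasure (restr P₁ n) := by unfold restr; infer_instance
  have := neg_llr h₁
  exact ae_of_ae_trim cylinderEvents_le_pi (this.mono fun x hx => hx.symm)

lemma logLR_swap_ae' {P₀ P₁ : Measure (ℕ → S)} [IsProbabilityMeasure P₀]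
    [IsProbabilityMeasure P₁] {n : ℕ} (h₀ : restr P₀ n ≪ restr P₁ n) :
    ∀ᵐ x ∂P₀, logLR P₁ P₀ n x = -logLR P₀ P₁ n x :=
  (logLR_swap_ae h₀).mono fun x hx => by rw [hx, neg_neg]

/-- The assumptions are symmetric in the two hypotheses, but `logLR` changes sign under the exchange
only almost surely, so each field is transferred along a null set. This is what reduces noise
streams to signals. -/
lemma StreamAssumptions.swap {P₀ P₁ : Measure (ℕ → S)} [IsProbabilityMeasure P₀]
    [IsProbabilityMeasure P₁] {I J : ℝ} (h : StreamAssumptions P₀ P₁ I J) :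
    StreamAssumptions P₁ P₀ J I where
  I_pos := h.J_pos
  J_pos := h.I_pos
  ac₁ := h.ac₀
  ac₀ := h.ac₁
  limsup₁ := by
    filter_upwards [h.limsup₀, ae_all_iff.2 fun n => logLR_swap_ae' (h.ac₀ n)] with x hx hs
    simpa only [hs] using hx
  limsup₀ := by
    filter_upwards [h.limsup₁, ae_all_iff.2 fun n => logLR_swap_ae (h.ac₁ n)] with x hx hs
    simpa only [hs, neg_neg] using hx
  complete₁ := fun ε hε => by
    refine (tsum_congr fun n => measure_congr ?_).trans_lt (h.complete₀ ε hε)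
    filter_upwards [logLR_swap_ae' (h.ac₀ (n + 1))] with x hx
    exact congrArg (fun y : ℝ => y / ((n + 1 : ℕ) : ℝ) ≤ J - ε) hx
  complete₀ := fun ε hε => by
    refine (tsum_congr fun n => measure_congr ?_).trans_lt (h.complete₁ ε hε)
    filter_upwards [logLR_swap_ae (h.ac₁ (n + 1))] with x hx
    exact congrArg (fun y : ℝ => y / ((n + 1 : ℕ) : ℝ) ≤ I - ε)
      (show -logLR P₁ P₀ (n + 1) x = _ by rw [hx, neg_neg])

lemma eventually_logLR_le {P₀ P₁ : Measure (ℕ → S)} {I J : ℝ}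
    (h : StreamAssumptions P₀ P₁ I J) :
    ∀ᵐ x ∂P₁, ∀ ε : ℝ, 0 < ε → ∀ᶠ n : ℕ in atTop, logLR P₀ P₁ n x ≤ (I + ε) * n := by
  filter_upwards [h.limsup₁] with x hx ε hε
  have h1 : limsup (fun n : ℕ => ((logLR P₀ P₁ n x / n : ℝ) : EReal)) atTop
      < ((I + ε : ℝ) : EReal) := hx.trans_lt (by exact_mod_cast lt_add_of_pos_right I hε)
  filter_upwards [eventually_lt_of_limsup_lt h1, eventually_gt_atTop 0] with n hn hn0
  have hn' : (0 : ℝ) < n := by exact_mod_cast hn0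
  have h2 : logLR P₀ P₁ n x / n < I + ε := by exact_mod_cast hn
  exact ((div_lt_iff₀ hn').1 h2).le

/-- Change of measure for one stream. -/
lemma measure_le_exp_mul {P₀ P₁ : Measure (ℕ → S)} [IsProbabilityMeasure P₀]
    [IsProbabilityMeasure P₁] {n : ℕ} (h₁ : restr P₁ n ≪ restr P₀ n)
    (h₀ : restr P₀ n ≪ restr P₁ n) {E : Set (ℕ → S)} (hE : MeasurableSet[pathSigma S n] E)
    {c : ℝ} (hc : ∀ x ∈ E, logLR P₀ P₁ n x ≤ c) :
    P₁ E ≤ ENNReal.ofReal (Real.exp c) * P₀ E := by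
  rw [measure_eq_setLIntegral_exp_logLR h₁ h₀ hE, ← setLIntegral_const]
  refine setLIntegral_mono' (cylinderEvents_le_pi _ hE) fun x hx => ?_
  gcongr
  exact hc x hx

end OneStream

/-! ### Likelihood ratios and change of measure for the joint laws -/

section Joint

variable {K : ℕ} {S : Fin K → Type*} [∀ k, MeasurableSpace (S k)]

lemma localSigma_le_globalSigma (k : Fin K) (n : ℕ) : localSigma S k n ≤ globalSigma S n :=
  le_iSup (fun k => localSigma S k n) k

lemma localSigma_mono (k : Fin K) : Monotone (localSigma S k) := fun _ _ h =>
  MeasurableSpace.comap_mono (pathSigma_mono h)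

lemma globalSigma_mono : Monotone (globalSigma S) := fun _ _ h =>
  iSup_mono fun k => localSigma_mono k h

lemma globalSigma_le (n : ℕ) : globalSigma S n ≤ MeasurableSpace.pi :=
  iSup_mono fun _ => MeasurableSpace.comap_mono (cylinderEvents_le_pi (Δ := Set.Iio n))

lemma localSigma_le (k : Fin K) (n : ℕ) : localSigma S k n ≤ MeasurableSpace.pi :=
  (localSigma_le_globalSigma k n).trans (globalSigma_le n)

lemma measurable_logLR_eval (P₀ P₁ : ∀ k, Measure (ℕ → S k)) (k : Fin K) (n : ℕ) :
    Measurable[localSigma S k n] (fun ω : ∀ k, ℕ → S k => logLR (P₀ k) (P₁ k) n (ω k)) :=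
  (measurable_logLR_pathSigma (P₀ k) (P₁ k) n).comp
    (comap_measurable (m := pathSigma (S k) n) (fun ω : ∀ k, ℕ → S k => ω k))

variable (P₀ P₁ : ∀ k, Measure (ℕ → S k))

/-- The log-likelihood ratio of `jointLaw P₀ P₁ A` versus `jointLaw P₀ P₁ ∅` on the first `n`
observations of all streams. -/
noncomputable def sumLogLR (A : Finset (Fin K)) (n : ℕ) (ω : ∀ k, ℕ → S k) : ℝ :=
  ∑ k ∈ A, logLR (P₀ k) (P₁ k) n (ω k)

lemma measurable_sumLogLR (A : Finset (Fin K)) (n : ℕ) :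
    Measurable[globalSigma S n] (sumLogLR P₀ P₁ A n) :=
  @Finset.measurable_fun_sum _ _ _ _ _ _ (globalSigma S n) _ A fun k _ =>
    (measurable_logLR_eval P₀ P₁ k n).mono (localSigma_le_globalSigma k n) le_rfl

variable [∀ k, IsProbabilityMeasure (P₀ k)] [∀ k, IsProbabilityMeasure (P₁ k)]

instance isProbabilityMeasure_ite (A : Finset (Fin K)) (k : Fin K) :
    IsProbabilityMeasure (if k ∈ A then P₁ k else P₀ k) := by
  split_ifs <;> infer_instance

instance isProbabilityMeasure_jointLaw (A : Finset (Fin K)) :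
    IsProbabilityMeasure (jointLaw P₀ P₁ A) := by
  unfold jointLaw; infer_instance

lemma measurePreserving_jointLaw (A : Finset (Fin K)) (k : Fin K) :
    MeasurePreserving (fun ω : ∀ k, ℕ → S k => ω k) (jointLaw P₀ P₁ A)
      (if k ∈ A then P₁ k else P₀ k) :=
  measurePreserving_eval (fun k => if k ∈ A then P₁ k else P₀ k) k

lemma jointLaw_eval_of_mem {A : Finset (Fin K)} {k : Fin K} (hk : k ∈ A)
    {E : Set (ℕ → S k)} (hE : MeasurableSet E) :
    jointLaw P₀ P₁ A {ω | ω k ∈ E} = P₁ k E := by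
  have := (measurePreserving_jointLaw P₀ P₁ A k).measure_preimage hE.nullMeasurableSet
  rwa [if_pos hk] at this

lemma jointLaw_eval_of_notMem {A : Finset (Fin K)} {k : Fin K} (hk : k ∉ A)
    {E : Set (ℕ → S k)} (hE : MeasurableSet E) :
    jointLaw P₀ P₁ A {ω | ω k ∈ E} = P₀ k E := by
  have := (measurePreserving_jointLaw P₀ P₁ A k).measure_preimage hE.nullMeasurableSet
  rwa [if_neg hk] at this

lemma ae_jointLaw_of_mem {A : Finset (Fin K)} {k : Fin K} (hk : k ∈ A)
    {p : (ℕ → S k) → Prop} (hp : ∀ᵐ x ∂(P₁ k), p x) : ∀ᵐ ω ∂(jointLaw P₀ P₁ A), p (ω k) := by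
  have := (measurePreserving_jointLaw P₀ P₁ A k).quasiMeasurePreserving
  rw [if_pos hk] at this
  exact this.ae hp

lemma ae_jointLaw_of_notMem {A : Finset (Fin K)} {k : Fin K} (hk : k ∉ A)
    {p : (ℕ → S k) → Prop} (hp : ∀ᵐ x ∂(P₀ k), p x) : ∀ᵐ ω ∂(jointLaw P₀ P₁ A), p (ω k) := by
  have := (measurePreserving_jointLaw P₀ P₁ A k).quasiMeasurePreserving
  rw [if_neg hk] at this
  exact this.ae hp

variable {P₀ P₁}

/-- On a box the density is a product of functions of separate coordinates, so independence factors
the integral into one-stream integrals. -/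
lemma jointLaw_univ_pi_eq {n : ℕ} (h₁ : ∀ k, restr (P₁ k) n ≪ restr (P₀ k) n)
    (h₀ : ∀ k, restr (P₀ k) n ≪ restr (P₁ k) n) (A : Finset (Fin K))
    {E : ∀ k, Set (ℕ → S k)} (hE : ∀ k, MeasurableSet[pathSigma (S k) n] (E k)) :
    jointLaw P₀ P₁ A (Set.univ.pi E) = ∫⁻ ω in Set.univ.pi E,
      ENNReal.ofReal (Real.exp (sumLogLR P₀ P₁ A n ω)) ∂(jointLaw P₀ P₁ ∅) := by
  have hE' : ∀ k, MeasurableSet (E k) := fun k => cylinderEvents_le_pi _ (hE k)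
  set g : ∀ k, (ℕ → S k) → ℝ≥0∞ := fun k => (E k).indicator fun x =>
    if k ∈ A then ENNReal.ofReal (Real.exp (logLR (P₀ k) (P₁ k) n x)) else 1 with hg
  have hgm : ∀ k, Measurable (g k) := fun k => by
    refine Measurable.indicator ?_ (hE' k)
    split_ifs
    · exact (measurable_logLR (P₀ k) (P₁ k) n).exp.ennreal_ofReal
    · exact measurable_const
  have hint : ∀ k, ∫⁻ x, g k x ∂(P₀ k) = (if k ∈ A then P₁ k else P₀ k) (E k) := fun k => by
    rw [hg, lintegral_indicator (hE' k)]
    split_ifs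
    · exact (measure_eq_setLIntegral_exp_logLR (h₁ k) (h₀ k) (hE k)).symm
    · simp
  have hind : ProbabilityTheory.iIndepFun (fun k (ω : ∀ k, ℕ → S k) => g k (ω k))
      (jointLaw P₀ P₁ ∅) := by
    have : jointLaw P₀ P₁ ∅ = Measure.pi P₀ := by simp [jointLaw]
    rw [this]
    exact ProbabilityTheory.iIndepFun_pi fun k => (hgm k).aemeasurable
  have hkey := ProbabilityTheory.lintegral_prod_eq_prod_lintegral_of_indepFun Finset.univ _ hind
    fun k => (hgm k).comp (measurable_pi_apply k)
  have hmp : ∀ k, ∫⁻ ω, g k (ω k) ∂(jointLaw P₀ P₁ ∅) = ∫⁻ x, g k x ∂(P₀ k) := fun k => by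
    have := (measurePreserving_jointLaw P₀ P₁ ∅ k).lintegral_comp (hgm k)
    rwa [if_neg (Finset.notMem_empty k)] at this
  have hlhs : jointLaw P₀ P₁ A (Set.univ.pi E)
      = ∏ k, (if k ∈ A then P₁ k else P₀ k) (E k) := by
    unfold jointLaw; rw [Measure.pi_pi]
  rw [hlhs, ← lintegral_indicator (MeasurableSet.univ_pi hE')]
  simp only [hmp, hint] at hkey
  rw [← hkey]
  refine lintegral_congr fun ω => ?_
  by_cases hω : ω ∈ Set.univ.pi E
  · rw [Set.indicator_of_mem hω]
    have : ∀ k, g k (ω k)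
        = if k ∈ A then ENNReal.ofReal (Real.exp (logLR (P₀ k) (P₁ k) n (ω k))) else 1 :=
      fun k => by rw [hg]; exact Set.indicator_of_mem (hω k trivial) _
    simp only [this]
    rw [Finset.prod_ite_mem, Finset.univ_inter, sumLogLR, Real.exp_sum,
      ENNReal.ofReal_prod_of_nonneg fun _ _ => (Real.exp_pos _).le]
  · rw [Set.indicator_of_notMem hω]
    obtain ⟨k, hk⟩ : ∃ k, ω k ∉ E k := by simpa [Set.mem_pi] using hω
    exact Finset.prod_eq_zero (Finset.mem_univ k) (by rw [hg]; exact Set.indicator_of_notMem hk _)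

/-- Boxes form a π-system generating `globalSigma S n`, so the identity extends from them. Having
all laws relative to the pure-noise law makes every log-likelihood ratio between two signal sets a
difference of `sumLogLR`s. -/
lemma jointLaw_eq_setLIntegral {n : ℕ} (h₁ : ∀ k, restr (P₁ k) n ≪ restr (P₀ k) n)
    (h₀ : ∀ k, restr (P₀ k) n ≪ restr (P₁ k) n) (A : Finset (Fin K))
    {E : Set (∀ k, ℕ → S k)} (hE : MeasurableSet[globalSigma S n] E) :
    jointLaw P₀ P₁ A E = ∫⁻ ω in E,
      ENNReal.ofReal (Real.exp (sumLogLR P₀ P₁ A n ω)) ∂(jointLaw P₀ P₁ ∅) := by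
  rw [← withDensity_apply _ (globalSigma_le n _ hE)]
  have hbox : ∀ s ∈ Set.univ.pi '' Set.univ.pi
      (fun k => {s : Set (ℕ → S k) | MeasurableSet[pathSigma (S k) n] s}),
      jointLaw P₀ P₁ A s = (jointLaw P₀ P₁ ∅).withDensity
        (fun ω => ENNReal.ofReal (Real.exp (sumLogLR P₀ P₁ A n ω))) s := by
    rintro _ ⟨E, hE, rfl⟩
    have hE' : ∀ k, MeasurableSet[pathSigma (S k) n] (E k) := fun k => hE k trivial
    rw [withDensity_apply _ (MeasurableSet.univ_pi fun k => cylinderEvents_le_pi _ (hE' k))]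
    exact jointLaw_univ_pi_eq h₁ h₀ A hE'
  refine ext_on_measurableSpace_of_generate_finite _ _ hbox (globalSigma_le n)
    (@generateFrom_pi _ _ _ (fun k => pathSigma (S k) n)).symm
    (@isPiSystem_pi _ _ (fun k => pathSigma (S k) n)) ?_ hE
  exact hbox _ ⟨fun _ => Set.univ, fun k _ => @MeasurableSet.univ _ (pathSigma (S k) n), Set.pi_univ _⟩

/-- Change of measure between two sets of signals. -/
lemma jointLaw_le_exp_mul {n : ℕ} (h₁ : ∀ k, restr (P₁ k) n ≪ restr (P₀ k) n)
    (h₀ : ∀ k, restr (P₀ k) n ≪ restr (P₁ k) n) (A B : Finset (Fin K))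
    {E : Set (∀ k, ℕ → S k)} (hE : MeasurableSet[globalSigma S n] E) {c : ℝ}
    (hc : ∀ ω ∈ E, sumLogLR P₀ P₁ A n ω ≤ c + sumLogLR P₀ P₁ B n ω) :
    jointLaw P₀ P₁ A E ≤ ENNReal.ofReal (Real.exp c) * jointLaw P₀ P₁ B E := by
  rw [jointLaw_eq_setLIntegral h₁ h₀ A hE, jointLaw_eq_setLIntegral h₁ h₀ B hE,
    ← lintegral_const_mul' _ _ ENNReal.ofReal_ne_top]
  refine setLIntegral_mono' (globalSigma_le n _ hE) fun ω hω => ?_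
  rw [← ENNReal.ofReal_mul (Real.exp_pos c).le, ← Real.exp_add]
  gcongr
  exact hc ω hω

/-- An event of stream `i` depends on the signal set only through whether `i` belongs to it. Hence
`A` and `B` may differ arbitrarily elsewhere, and only the ratio of stream `i` enters. -/
lemma jointLaw_le_exp_mul_local {n : ℕ} (h₁ : ∀ k, restr (P₁ k) n ≪ restr (P₀ k) n)
    (h₀ : ∀ k, restr (P₀ k) n ≪ restr (P₁ k) n) {A B : Finset (Fin K)} {i : Fin K}
    (hiA : i ∈ A) (hiB : i ∉ B)
    {E : Set (∀ k, ℕ → S k)} (hE : MeasurableSet[localSigma S i n] E) {c : ℝ}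
    (hc : ∀ ω ∈ E, logLR (P₀ i) (P₁ i) n (ω i) ≤ c) :
    jointLaw P₀ P₁ A E ≤ ENNReal.ofReal (Real.exp c) * jointLaw P₀ P₁ B E := by
  obtain ⟨E', hE', rfl⟩ := hE
  -- The bound is known only at coordinates of joint paths; intersecting with the sublevel set makes
  -- it hold on all of `G` and leaves the preimage unchanged.
  set G : Set (ℕ → S i) := E' ∩ {x | logLR (P₀ i) (P₁ i) n x ≤ c} with hG
  have hGm : MeasurableSet[pathSigma (S i) n] G :=
    @MeasurableSet.inter _ (pathSigma (S i) n) _ _ hE'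
      (measurable_logLR_pathSigma (P₀ i) (P₁ i) n measurableSet_Iic)
  have hGm' : MeasurableSet G := cylinderEvents_le_pi _ hGm
  have heq : (fun ω : ∀ k, ℕ → S k => ω i) ⁻¹' E' = {ω | ω i ∈ G} := by
    ext ω
    exact ⟨fun h => ⟨h, hc ω h⟩, fun h => h.1⟩
  rw [heq, jointLaw_eval_of_mem P₀ P₁ hiA hGm', jointLaw_eval_of_notMem P₀ P₁ hiB hGm']
  exact measure_le_exp_mul (h₁ i) (h₀ i) hGm fun x hx => hx.2

end Joint

/-! ### Bounds on expected decision times -/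

section Decision

variable {Ω : Type*} [mΩ : MeasurableSpace Ω] {F : ℕ → MeasurableSpace Ω}

lemma IsDecision.measurable_T (hF : ∀ n, F n ≤ mΩ) {T : Ω → ℕ∞} {D : Ω → Bool}
    (h : IsDecision F T D) : Measurable T := by
  have hn : ∀ n : ℕ, MeasurableSet {ω | T ω = n} := fun n => hF n _ (h.time n)
  refine measurable_to_countable' fun t => ?_
  cases t with
  | coe n => exact hn n
  | top =>
    have : T ⁻¹' {⊤} = (⋃ n : ℕ, {ω | T ω = n})ᶜ := by
      ext ω
      cases hT : T ω <;> simp [hT]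
    rw [this]
    exact (MeasurableSet.iUnion hn).compl

lemma enat_toENNReal_eq_tsum (t : ℕ∞) :
    (t : ℝ≥0∞) = ∑' n : ℕ, if (n : ℕ∞) < t then (1 : ℝ≥0∞) else 0 := by
  cases t with
  | top => simp
  | coe t =>
    rw [tsum_eq_sum (s := Finset.range t)]
    · rw [Finset.sum_congr rfl (g := fun _ => (1 : ℝ≥0∞))]
      · simp
      · intro n hn
        simpa using hn
    · intro n hn
      simpa using hn

/-- If `Λ n` exceeds `r * n` up to summable probabilities, then a random time which occurs no later
than the first exceedance of the level `a` by `Λ` has expectation at most `a / r + C`. -/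
lemma exists_lintegral_le_of_exceedance {P : Measure Ω} [IsProbabilityMeasure P]
    {Λ : ℕ → Ω → ℝ} (hΛ : ∀ n, Measurable (Λ n)) {r : ℝ} (hr : 0 < r)
    (hsum : ∑' n : ℕ, P {ω | Λ (n + 1) ω / (n + 1 : ℕ) ≤ r} < ∞) :
    ∃ C : ℝ≥0∞, C < ∞ ∧ ∀ (a : ℝ) (T : Ω → ℕ∞),
      (∀ n : ℕ, 1 ≤ n → ∀ ω, a ≤ Λ n ω → T ω ≤ n) →
      ∫⁻ ω, (T ω : ℝ≥0∞) ∂P ≤ ENNReal.ofReal (a / r) + C := by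
  set G : ℕ → Set Ω := fun n => {ω | Λ (n + 1) ω / (n + 1 : ℕ) ≤ r} with hG
  have hGm : ∀ n, MeasurableSet (G n) := fun n =>
    measurableSet_le ((hΛ (n + 1)).div_const _) measurable_const
  -- The expectation is the sum of `P (T > n)`. For `n + 1` in place of `n`, the event forces `n + 1
  -- < a / r` or `G n`. The `2` pays for the term `n = 0` and for rounding `a / r` up; nothing in it
  -- depends on `a`.
  refine ⟨2 + ∑' n, P (G n), ENNReal.add_lt_top.2 ⟨by simp, hsum⟩, fun a T hT => ?_⟩
  set M : ℕ := ⌈a / r⌉₊ with hM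
  have hpt : ∀ ω, (T ω : ℝ≥0∞) ≤ 1 + M + ∑' n, (G n).indicator 1 ω := fun ω => by
    have hMsum := enat_toENNReal_eq_tsum (M : ℕ∞)
    rw [ENat.toENNReal_coe] at hMsum
    rw [enat_toENNReal_eq_tsum, tsum_eq_zero_add' ENNReal.summable, add_assoc, hMsum,
      ← ENNReal.tsum_add]
    refine add_le_add (by split_ifs <;> simp) (ENNReal.tsum_le_tsum fun n => ?_)
    by_cases h : ((n + 1 : ℕ) : ℕ∞) < T ω
    · rw [if_pos h]
      by_cases hGn : ω ∈ G n
      · rw [Set.indicator_of_mem hGn]; exact le_add_self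
      · have hlt : Λ (n + 1) ω < a := by
          by_contra! hle
          exact absurd (hT (n + 1) (by omega) ω hle) (not_le.2 h)
        have hn : (0 : ℝ) < (n + 1 : ℕ) := by positivity
        have h1 : r * (n + 1 : ℕ) < Λ (n + 1) ω := by
          rw [← lt_div_iff₀ hn]
          exact not_le.1 hGn
        have h2 : ((n + 1 : ℕ) : ℝ) < a / r := by
          rw [lt_div_iff₀ hr]; linarith
        have h3 : n < M := by
          have h4 : ((n + 1 : ℕ) : ℝ) < M := h2.trans_le (Nat.le_ceil _)
          have : n + 1 < M := by exact_mod_cast h4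
          omega
        rw [if_pos (by exact_mod_cast h3)]
        exact le_self_add
    · rw [if_neg h]; exact zero_le
  have hMle : (M : ℝ≥0∞) ≤ ENNReal.ofReal (a / r) + 1 := by
    rw [← ENNReal.ofReal_natCast, ← ENNReal.ofReal_one]
    rcases le_total (a / r) 0 with h | h
    · rw [hM, Nat.ceil_eq_zero.2 h]; simp
    · rw [← ENNReal.ofReal_add h zero_le_one]
      exact ENNReal.ofReal_le_ofReal (Nat.ceil_lt_add_one h).le
  calc ∫⁻ ω, (T ω : ℝ≥0∞) ∂P ≤ ∫⁻ ω, 1 + M + ∑' n, (G n).indicator 1 ω ∂P := lintegral_mono hpt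
    _ = 1 + M + ∑' n, P (G n) := by
      rw [lintegral_add_left measurable_const,
        lintegral_tsum fun n => (measurable_one.indicator (hGm n)).aemeasurable]
      simp [lintegral_indicator_one (hGm _)]
    _ ≤ 1 + (ENNReal.ofReal (a / r) + 1) + ∑' n, P (G n) := by gcongr
    _ = _ := by rw [show (2 : ℝ≥0∞) = 1 + 1 by norm_num]; ring

/-- Almost surely, `Λ n ≤ r * n ≤ s * m` from some time on, and the finitely many earlier values are
below `s * m` once `m` is large. So the indicators tend to zero almost surely. -/
lemma tendsto_measure_exceedance_zero {P : Measure Ω} [IsProbabilityMeasure P]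
    {Λ : ℕ → Ω → ℝ} (hΛm : ∀ n, Measurable (Λ n)) {s : ℝ} (hs : 0 < s)
    (hΛ : ∀ᵐ ω ∂P, ∃ r < s, ∀ᶠ n : ℕ in atTop, Λ n ω ≤ r * n) :
    Tendsto (fun m : ℕ => P {ω | ∃ n ≤ m, s * m < Λ n ω}) atTop (𝓝 0) := by
  rw [← measure_empty (μ := P)]
  refine tendsto_measure_of_ae_tendsto_indicator_of_isFiniteMeasure atTop MeasurableSet.empty
    (fun m => ?_) ?_
  · have : {ω | ∃ n ≤ m, s * m < Λ n ω} = ⋃ n ∈ Set.Iic m, {ω | s * m < Λ n ω} := by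
      ext; simp
    rw [this]
    exact MeasurableSet.biUnion (Set.to_countable _)
      fun n _ => measurableSet_lt measurable_const (hΛm n)
  · filter_upwards [hΛ] with ω ⟨r, hrs, hω⟩
    obtain ⟨N, hN⟩ := eventually_atTop.1 hω
    obtain ⟨C, hC⟩ := ((Set.finite_Iio N).image fun n => Λ n ω).bddAbove
    have hlim : Tendsto (fun m : ℕ => s * (m : ℝ)) atTop atTop :=
      tendsto_natCast_atTop_atTop.const_mul_atTop hs
    filter_upwards [hlim.eventually_ge_atTop C] with m hm
    simp only [Set.mem_empty_iff_false, iff_false, not_exists, not_and, not_lt]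
    intro n hn
    by_cases hnN : n < N
    · exact (hC ⟨n, hnN, rfl⟩).trans hm
    · have hnm : (n : ℝ) ≤ m := by exact_mod_cast hn
      have h1 : r * n ≤ s * n := by gcongr
      have h2 : s * n ≤ s * m := by gcongr
      linarith [hN n (not_lt.1 hnN)]

lemma tendsto_neg_log_fst_atTop :
    Tendsto (fun p : ℝ × ℝ => -Real.log p.1) (𝓝[>] 0 ×ˢ 𝓝[>] 0) atTop :=
  (tendsto_neg_atBot_atTop.comp Real.tendsto_log_nhdsGT_zero).comp tendsto_fst

/-- A decision with errors at most `α` under `Q` and at most `β` under `P` takes on average at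
least about `-log α / R` steps under `P`, when the log-likelihood ratio `Λ` of `P` versus `Q` grows
at most at rate `R` under `P`. -/
lemma eventually_le_lintegral_decision (hF : ∀ n, F n ≤ mΩ) {P Q : Measure Ω}
    [IsProbabilityMeasure P] {Λ : ℕ → Ω → ℝ} (hΛm : ∀ n, Measurable[F n] (Λ n)) {R : ℝ}
    (hR : 0 < R) (hΛ : ∀ᵐ ω ∂P, ∀ ε : ℝ, 0 < ε → ∀ᶠ n : ℕ in atTop, Λ n ω ≤ (R + ε) * n)
    (hcm : ∀ (n : ℕ) (c : ℝ) (E : Set Ω), MeasurableSet[F n] E → (∀ ω ∈ E, Λ n ω ≤ c) →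
      P E ≤ ENNReal.ofReal (Real.exp c) * Q E) {r : ℝ} (hr : r < 1 / R) :
    ∀ᶠ p : ℝ × ℝ in 𝓝[>] 0 ×ˢ 𝓝[>] 0, ∀ (T : Ω → ℕ∞) (D : Ω → Bool), IsDecision F T D →
      Q {ω | D ω = true} ≤ ENNReal.ofReal p.1 → P {ω | D ω = false} ≤ ENNReal.ofReal p.2 →
      ENNReal.ofReal (r * -Real.log p.1) ≤ ∫⁻ ω, (T ω : ℝ≥0∞) ∂P := by
  have hx := tendsto_neg_log_fst_atTop
  rcases le_or_gt r 0 with hr0 | hr0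
  · filter_upwards [hx.eventually_ge_atTop 0] with p hp T D _ _ _
    rw [ENNReal.ofReal_of_nonpos (mul_nonpos_of_nonpos_of_nonneg hr0 hp)]
    exact zero_le
  -- The horizon will be `m ≈ r' * x` and the level `s * m`, with `r < r' < 1 / R` and `R < s < 1 /
  -- r'`. Then `R < s` makes crossing the level by time `m` unlikely, `s * r' < 1` makes `exp (s *
  -- m) * α` vanish, and `η = 1 - r / r'` is the probability that may be lost.
  obtain ⟨r', hrr', hr'⟩ := exists_between hr
  have hr'0 : 0 < r' := hr0.trans hrr'
  have hRr' : R < 1 / r' := by rwa [lt_div_comm₀ hR hr'0]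
  obtain ⟨s, hRs, hs⟩ := exists_between hRr'
  have hs0 : 0 < s := hR.trans hRs
  have hθ : s * r' < 1 := by rwa [lt_div_iff₀ hr'0] at hs
  set η : ℝ := 1 - r / r' with hη
  have hη0 : 0 < η := by rw [hη, sub_pos, div_lt_one hr'0]; exact hrr'
  have hη3 : 0 < η / 3 := by positivity
  have hB := tendsto_measure_exceedance_zero (P := P) (fun n => (hΛm n).mono (hF n) le_rfl) hs0 (by
    filter_upwards [hΛ] with ω hω
    exact ⟨R + (s - R) / 2, by linarith, hω _ (by linarith)⟩)
  have hm : Tendsto (fun p : ℝ × ℝ => ⌊r' * -Real.log p.1⌋₊) (𝓝[>] 0 ×ˢ 𝓝[>] 0) atTop :=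
    tendsto_nat_floor_atTop.comp (hx.const_mul_atTop hr'0)
  have hexp : Tendsto (fun p : ℝ × ℝ => Real.exp ((s * r' - 1) * -Real.log p.1))
      (𝓝[>] 0 ×ˢ 𝓝[>] 0) (𝓝 0) :=
    Real.tendsto_exp_atBot.comp (hx.const_mul_atTop_of_neg (by linarith))
  have hβ : ∀ᶠ p : ℝ × ℝ in 𝓝[>] 0 ×ˢ 𝓝[>] 0, p.2 < η / 3 :=
    tendsto_snd.eventually (eventually_nhdsWithin_of_eventually_nhds (eventually_lt_nhds hη3))
  have hα : ∀ᶠ p : ℝ × ℝ in 𝓝[>] 0 ×ˢ 𝓝[>] 0, 0 < p.1 :=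
    tendsto_fst.eventually (eventually_mem_nhdsWithin)
  filter_upwards [hx.eventually_ge_atTop 0, hα, hβ, hexp.eventually_lt_const hη3,
    (hB.comp hm).eventually_lt_const (ENNReal.ofReal_pos.2 hη3)]
    with p hp0 hα hβ hexp hB T D hTD hQ hP
  set x : ℝ := -Real.log p.1 with hxdef
  set m : ℕ := ⌊r' * x⌋₊ with hmdef
  have hpα : p.1 = Real.exp (-x) := by rw [hxdef, neg_neg, Real.exp_log hα]
  have hmx : (m : ℝ) ≤ r' * x := Nat.floor_le (by positivity)
  set E : ℕ → Set Ω := fun n => {ω | T ω = n ∧ D ω = true} with hE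
  set G : ℕ → Set Ω := fun n => E n ∩ {ω | Λ n ω ≤ s * m} with hGdef
  have hEm : ∀ n, MeasurableSet (E n) := fun n => hF n _ (hTD.decision n true)
  have hG : ∑ n ∈ Finset.range (m + 1), P (G n) ≤ ENNReal.ofReal (η / 3) := by
    have h1 : ∀ n ∈ Finset.range (m + 1),
        P (G n) ≤ ENNReal.ofReal (Real.exp (s * m)) * Q (E n) := fun n _ => by
      refine (hcm n (s * m) (G n) ?_ fun ω hω => hω.2).trans (by gcongr; exact Set.inter_subset_left)
      exact @MeasurableSet.inter _ (F n) _ _ (hTD.decision n true) (hΛm n measurableSet_Iic)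
    have h2 : ∑ n ∈ Finset.range (m + 1), Q (E n) ≤ ENNReal.ofReal p.1 := by
      rw [← measure_biUnion_finset _ fun n _ => hEm n]
      · refine (measure_mono ?_).trans hQ
        simp only [hE, Set.iUnion_subset_iff]
        exact fun _ _ ω hω => hω.2
      · intro a _ b _ hab
        refine Set.disjoint_left.2 fun ω ha hb => hab ?_
        exact_mod_cast ha.1.symm.trans hb.1
    calc ∑ n ∈ Finset.range (m + 1), P (G n)
        ≤ ∑ n ∈ Finset.range (m + 1), ENNReal.ofReal (Real.exp (s * m)) * Q (E n) :=
          Finset.sum_le_sum h1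
      _ ≤ ENNReal.ofReal (Real.exp (s * m)) * ENNReal.ofReal p.1 := by
          rw [← Finset.mul_sum]; gcongr
      _ ≤ ENNReal.ofReal (Real.exp ((s * r' - 1) * x)) := by
          rw [← ENNReal.ofReal_mul (Real.exp_pos _).le, hpα, ← Real.exp_add]
          gcongr
          nlinarith
      _ ≤ _ := ENNReal.ofReal_le_ofReal hexp.le
  -- Stopping by time `m` means a missed signal, an early crossing of the level, or a detection
  -- below it. Each has probability at most `η / 3`; for the last, this is the change of measure.
  have hcover : (Set.univ : Set Ω) ⊆ {ω | (m : ℕ∞) < T ω} ∪ ({ω | D ω = false} ∪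
      ({ω | ∃ n ≤ m, s * m < Λ n ω} ∪ ⋃ n ∈ Finset.range (m + 1), G n)) := by
    intro ω _
    by_cases h1 : (m : ℕ∞) < T ω
    · exact Or.inl h1
    cases hD : D ω with
    | false => exact Or.inr (Or.inl hD)
    | true =>
      refine Or.inr (Or.inr ?_)
      obtain ⟨n, hn⟩ := ENat.ne_top_iff_exists.1
        (ne_top_of_le_ne_top (ENat.natCast_ne_top m) (not_lt.1 h1))
      have hnm : n ≤ m := by
        rw [← hn] at h1
        exact_mod_cast not_lt.1 h1
      rcases lt_or_ge (s * m) (Λ n ω) with h | h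
      · exact Or.inl ⟨n, hnm, h⟩
      · refine Or.inr (Set.mem_biUnion (x := n) ?_ ⟨⟨hn.symm, hD⟩, h⟩)
        exact Finset.mem_coe.2 (Finset.mem_range.2 (by omega))
  have hprob : 1 ≤ P {ω | (m : ℕ∞) < T ω} + ENNReal.ofReal η := by
    calc (1 : ℝ≥0∞) = P Set.univ := measure_univ.symm
      _ ≤ _ := measure_mono hcover
      _ ≤ P {ω | (m : ℕ∞) < T ω} + (P {ω | D ω = false} +
          (P {ω | ∃ n ≤ m, s * m < Λ n ω} + ∑ n ∈ Finset.range (m + 1), P (G n))) := by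
        refine (measure_union_le _ _).trans ?_
        gcongr
        refine (measure_union_le _ _).trans ?_
        gcongr
        refine (measure_union_le _ _).trans ?_
        gcongr
        exact measure_biUnion_finset_le _ _
      _ ≤ P {ω | (m : ℕ∞) < T ω} + (ENNReal.ofReal (η / 3) +
          (ENNReal.ofReal (η / 3) + ENNReal.ofReal (η / 3))) := by
        gcongr
        · exact hP.trans (ENNReal.ofReal_le_ofReal hβ.le)
        · exact hB.le
      _ = _ := by
        rw [← ENNReal.ofReal_add hη3.le hη3.le, ← ENNReal.ofReal_add hη3.le (by positivity)]
        congr 2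
        ring
  have hprob' : ENNReal.ofReal (r / r') ≤ P {ω | (m : ℕ∞) < T ω} := by
    have : r / r' = 1 - η := by rw [hη]; ring
    rw [this, ENNReal.ofReal_sub _ hη0.le, ENNReal.ofReal_one]
    exact tsub_le_iff_right.2 hprob
  have hTm : Measurable fun ω => (T ω : ℝ≥0∞) :=
    (measurable_of_countable _).comp (hTD.measurable_T hF)
  -- Markov's inequality at `m + 1 ≥ r' * x`, with `P (T > m) ≥ r / r'`.
  calc ENNReal.ofReal (r * x) = ENNReal.ofReal (r' * x) * ENNReal.ofReal (r / r') := by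
        rw [← ENNReal.ofReal_mul (by positivity)]
        congr 1
        field_simp
    _ ≤ ((m + 1 : ℕ) : ℝ≥0∞) * P {ω | (m : ℕ∞) < T ω} := by
        gcongr
        rw [← ENNReal.ofReal_natCast]
        refine ENNReal.ofReal_le_ofReal ?_
        push_cast
        exact (Nat.lt_floor_add_one _).le
    _ ≤ ((m + 1 : ℕ) : ℝ≥0∞) * P {ω | ((m + 1 : ℕ) : ℝ≥0∞) ≤ (T ω : ℝ≥0∞)} := by
        gcongr with ω
        intro h
        have : ((m + 1 : ℕ) : ℕ∞) ≤ T ω := by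
          push_cast
          exact Order.add_one_le_of_lt h
        exact_mod_cast ENat.toENNReal_le.2 this
    _ ≤ _ := mul_meas_ge_le_lintegral hTm _

/-- The constants `c` and `C` may depend on `r` but not on the levels, so they vanish after division
by `-log α`; then `r` tends to its bound on either side. -/
lemma tendsto_div_neg_log {f : ℝ × ℝ → ℝ≥0∞} {R : ℝ} (hR : 0 < R)
    (hlow : ∀ r < 1 / R, ∀ᶠ p : ℝ × ℝ in 𝓝[>] 0 ×ˢ 𝓝[>] 0,
      ENNReal.ofReal (r * -Real.log p.1) ≤ f p)
    (hup : ∀ r : ℝ, 0 < r → r < R → ∃ (c : ℝ) (C : ℝ≥0∞), C < ∞ ∧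
      ∀ᶠ p : ℝ × ℝ in 𝓝[>] 0 ×ˢ 𝓝[>] 0, f p ≤ ENNReal.ofReal ((-Real.log p.1 + c) / r) + C) :
    Tendsto (fun p : ℝ × ℝ => f p / ENNReal.ofReal (-Real.log p.1)) (𝓝[>] 0 ×ˢ 𝓝[>] 0)
      (𝓝 (ENNReal.ofReal (1 / R))) := by
  have hx := tendsto_neg_log_fst_atTop
  have hR' : 0 < 1 / R := by positivity
  refine tendsto_order.2 ⟨fun a ha => ?_, fun b hb => ?_⟩
  · have hat : a ≠ ∞ := ha.ne_top
    have : a.toReal < 1 / R := by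
      rwa [← ENNReal.ofReal_toReal hat, ENNReal.ofReal_lt_ofReal_iff hR'] at ha
    obtain ⟨r, har, hr⟩ := exists_between this
    filter_upwards [hx.eventually_gt_atTop 0, hlow r hr] with p hp hf
    rw [ENNReal.lt_div_iff_mul_lt (Or.inl (ENNReal.ofReal_pos.2 hp).ne')
      (Or.inl ENNReal.ofReal_ne_top)]
    refine lt_of_lt_of_le ?_ hf
    rw [← ENNReal.ofReal_toReal hat, ← ENNReal.ofReal_mul ENNReal.toReal_nonneg]
    have h0 : 0 ≤ a.toReal := ENNReal.toReal_nonneg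
    exact (ENNReal.ofReal_lt_ofReal_iff (mul_pos (h0.trans_lt har) hp)).2 (by gcongr)
  · obtain ⟨q, hq, hqb⟩ := ENNReal.lt_iff_exists_nnreal_btwn.1 hb
    have hRq : 1 / R < (q : ℝ) := by
      rwa [← ENNReal.ofReal_coe_nnreal, ENNReal.ofReal_lt_ofReal_iff_of_nonneg hR'.le] at hq
    have hq0 : 0 < (q : ℝ) := hR'.trans hRq
    have hqR : 1 / (q : ℝ) < R := by rwa [div_lt_comm₀ hq0 hR]
    obtain ⟨r, hr, hrR⟩ := exists_between hqR
    have hr0 : 0 < r := (by positivity : (0 : ℝ) < 1 / q).trans hr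
    obtain ⟨c, C, hC, hf⟩ := hup r hr0 hrR
    have hrq : 0 < q - 1 / r := by
      rw [sub_pos, div_lt_comm₀ hr0 hq0]; exact hr
    filter_upwards [hx.eventually_gt_atTop 0, hx.eventually_ge_atTop (-c), hf,
      (hx.const_mul_atTop hrq).eventually_ge_atTop (c / r + C.toReal)] with p hp hpc hf hpC
    refine lt_of_le_of_lt ?_ hqb
    refine ENNReal.div_le_of_le_mul (hf.trans ?_)
    rw [← ENNReal.ofReal_toReal hC.ne, ← ENNReal.ofReal_coe_nnreal,
      ← ENNReal.ofReal_mul hq0.le,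
      ← ENNReal.ofReal_add (div_nonneg (by linarith) hr0.le) ENNReal.toReal_nonneg]
    refine ENNReal.ofReal_le_ofReal ?_
    rw [add_div]
    have : (q - 1 / r) * -Real.log p.1 = q * -Real.log p.1 - -Real.log p.1 / r := by ring
    linarith

end Decision

/-! ### First exit times and the decisions made there -/

section Exit

variable {Ω : Type*}

open Classical in
/-- The first time `n ≥ 1` at which the path is in `U n ∪ V n`. -/
noncomputable def firstExit (U V : ℕ → Set Ω) (ω : Ω) : ℕ∞ :=
  if h : ∃ n, 1 ≤ n ∧ ω ∈ U n ∪ V n then (Nat.find h : ℕ∞) else ⊤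

open Classical in
/-- The decision that is positive when the path is in `U n` at its first exit time `n`. -/
noncomputable def exitDecision (U V : ℕ → Set Ω) (ω : Ω) : Bool :=
  decide (∃ n : ℕ, firstExit U V ω = n ∧ ω ∈ U n)

variable {U V : ℕ → Set Ω}

open Classical in
lemma firstExit_eq_coe_iff {ω : Ω} {n : ℕ} :
    firstExit U V ω = n ↔ (1 ≤ n ∧ ω ∈ U n ∪ V n) ∧ ∀ m < n, ¬(1 ≤ m ∧ ω ∈ U m ∪ V m) := by
  unfold firstExit
  split_ifs with h
  · rw [Nat.cast_inj, Nat.find_eq_iff]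
  · refine ⟨fun h' => absurd h'.symm (ENat.natCast_ne_top n), fun h' => absurd ⟨n, h'.1⟩ h⟩

lemma firstExit_le {ω : Ω} {n : ℕ} (hn : 1 ≤ n) (h : ω ∈ U n ∪ V n) :
    firstExit U V ω ≤ n := by
  have h' : ∃ n, 1 ≤ n ∧ ω ∈ U n ∪ V n := ⟨n, hn, h⟩
  classical
  rw [firstExit, dif_pos h']
  exact_mod_cast Nat.find_min' h' ⟨hn, h⟩

lemma one_le_firstExit (ω : Ω) : 1 ≤ firstExit U V ω := by
  cases h : firstExit U V ω with
  | top => exact le_top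
  | coe n => exact_mod_cast (firstExit_eq_coe_iff.1 h).1.1

lemma exitDecision_eq_true_iff {ω : Ω} :
    exitDecision U V ω = true ↔ ∃ n : ℕ, firstExit U V ω = n ∧ ω ∈ U n := by
  simp [exitDecision]

/-- `exitDecision` is also `false` on paths that never exit, hence the finiteness hypothesis. -/
lemma mem_iUnion_of_exitDecision_false {ω : Ω} (hT : firstExit U V ω < ⊤)
    (hD : exitDecision U V ω = false) : ω ∈ ⋃ n, V n := by
  obtain ⟨n, hn⟩ := ENat.ne_top_iff_exists.1 hT.ne
  have h1 : ω ∉ U n := fun h => by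
    rw [exitDecision_eq_true_iff.2 ⟨n, hn.symm, h⟩] at hD
    exact absurd hD (by simp)
  rcases (firstExit_eq_coe_iff.1 hn.symm).1.2 with h | h
  · exact absurd h h1
  · exact Set.mem_iUnion.2 ⟨n, h⟩

/-- The filtration is arbitrary because both cases occur: `globalSigma` for general procedures,
`localSigma` to show that one is decentralized. -/
lemma isDecision_firstExit [mΩ : MeasurableSpace Ω] {F : ℕ → MeasurableSpace Ω}
    (hF : Monotone F) (hle : ∀ n, F n ≤ mΩ) (hU : ∀ n, MeasurableSet[F n] (U n))
    (hV : ∀ n, MeasurableSet[F n] (V n)) :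
    IsDecision F (firstExit U V) (exitDecision U V) := by
  have hW : ∀ m n, m ≤ n → MeasurableSet[F n] {ω | 1 ≤ m ∧ ω ∈ U m ∪ V m} := fun m n h =>
    @MeasurableSet.inter _ (F n) _ _ (@MeasurableSet.const _ (F n) (1 ≤ m))
      (hF h _ (@MeasurableSet.union _ (F m) _ _ (hU m) (hV m)))
  have htime : ∀ n : ℕ, MeasurableSet[F n] {ω | firstExit U V ω = n} := fun n => by
    have : {ω | firstExit U V ω = n} = {ω | 1 ≤ n ∧ ω ∈ U n ∪ V n} ∩
        ⋂ m ∈ Set.Iio n, {ω | 1 ≤ m ∧ ω ∈ U m ∪ V m}ᶜ := by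
      ext ω
      rw [Set.mem_inter_iff, Set.mem_iInter₂]
      exact firstExit_eq_coe_iff
    rw [this]
    exact @MeasurableSet.inter _ (F n) _ _ (hW n n le_rfl)
      (@MeasurableSet.biInter _ _ (F n) _ _ (Set.to_countable _)
        fun m hm => @MeasurableSet.compl _ _ (F n) (hW m n (le_of_lt hm)))
  have htrue : ∀ n : ℕ, MeasurableSet[F n]
      {ω | firstExit U V ω = n ∧ exitDecision U V ω = true} := fun n => by
    have : {ω | firstExit U V ω = n ∧ exitDecision U V ω = true}
        = {ω | firstExit U V ω = n} ∩ U n := by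
      ext ω
      constructor
      · rintro ⟨h1, h2⟩
        obtain ⟨m, h3, h4⟩ := exitDecision_eq_true_iff.1 h2
        have : m = n := by exact_mod_cast h3.symm.trans h1
        exact ⟨h1, this ▸ h4⟩
      · rintro ⟨h1, h2⟩
        exact ⟨h1, exitDecision_eq_true_iff.2 ⟨n, h1, h2⟩⟩
    rw [this]
    exact @MeasurableSet.inter _ (F n) _ _ (htime n) (hU n)
  refine ⟨one_le_firstExit, ?_, htime, fun n i => ?_⟩
  · refine measurable_to_bool ?_
    have : exitDecision U V ⁻¹' {true}
        = ⋃ n : ℕ, {ω | firstExit U V ω = n ∧ exitDecision U V ω = true} := by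
      ext ω
      simp only [Set.mem_preimage, Set.mem_singleton_iff, Set.mem_iUnion]
      exact ⟨fun h => (exitDecision_eq_true_iff.1 h).imp fun n hn => ⟨hn.1, h⟩, fun ⟨_, h⟩ => h.2⟩
    rw [this]
    exact MeasurableSet.iUnion fun n => hle n _ (htrue n)
  · cases i with
    | true => exact htrue n
    | false =>
      have : {ω | firstExit U V ω = n ∧ exitDecision U V ω = false}
          = {ω | firstExit U V ω = n} \ {ω | firstExit U V ω = n ∧ exitDecision U V ω = true} := by
        ext ω
        rw [Set.mem_sdiff]
        change _ ∧ _ ↔ _ = _ ∧ ¬(_ ∧ _)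
        cases exitDecision U V ω <;> simp
      rw [this]
      exact @MeasurableSet.diff _ (F n) _ _ (htime n) (htrue n)

end Exit

/-! ### Error control for exit procedures -/

section ExitProcedure

variable {K : ℕ} {S : Fin K → Type*} [∀ k, MeasurableSpace (S k)]

/-- The procedure that stops in stream `k` when the path enters `U k n ∪ V k n`, and declares a
signal if it is then in `U k n`. -/
noncomputable def exitProcedure (U V : Fin K → ℕ → Set (∀ k, ℕ → S k))
    (hU : ∀ k n, MeasurableSet[globalSigma S n] (U k n))
    (hV : ∀ k n, MeasurableSet[globalSigma S n] (V k n)) : Procedure S where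
  T := fun k => firstExit (U k) (V k)
  D := fun k => exitDecision (U k) (V k)
  isDecision := fun k => isDecision_firstExit globalSigma_mono globalSigma_le (hU k) (hV k)

variable {P₀ P₁ : ∀ k, Measure (ℕ → S k)}

lemma measurableSet_le_logLR (k : Fin K) (n : ℕ) (a : ℝ) :
    MeasurableSet[localSigma S k n] {ω | a ≤ logLR (P₀ k) (P₁ k) n (ω k)} :=
  measurable_logLR_eval P₀ P₁ k n measurableSet_Ici

lemma measurableSet_logLR_le (k : Fin K) (n : ℕ) (a : ℝ) :
    MeasurableSet[localSigma S k n] {ω | logLR (P₀ k) (P₁ k) n (ω k) ≤ a} :=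
  measurable_logLR_eval P₀ P₁ k n measurableSet_Iic

lemma measurableSet_le_logLR_sub (k j : Fin K) (n : ℕ) (a : ℝ) :
    MeasurableSet[globalSigma S n]
      {ω | a ≤ logLR (P₀ k) (P₁ k) n (ω k) - logLR (P₀ j) (P₁ j) n (ω j)} :=
  (Measurable.fun_sub (m := globalSigma S n)
    ((measurable_logLR_eval P₀ P₁ k n).mono (localSigma_le_globalSigma k n) le_rfl)
    ((measurable_logLR_eval P₀ P₁ j n).mono (localSigma_le_globalSigma j n) le_rfl))
    measurableSet_Ici

lemma measurable_logLR_eval' (k : Fin K) (n : ℕ) :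
    Measurable (fun ω : ∀ k, ℕ → S k => logLR (P₀ k) (P₁ k) n (ω k)) :=
  (measurable_logLR_eval P₀ P₁ k n).mono (localSigma_le k n) le_rfl

variable [∀ k, IsProbabilityMeasure (P₀ k)] [∀ k, IsProbabilityMeasure (P₁ k)]
    {I J : Fin K → ℝ}

/-- Ville's inequality for the likelihood ratio of two joint laws. -/
lemma jointLaw_iUnion_le (hP : ∀ k, StreamAssumptions (P₀ k) (P₁ k) (I k) (J k))
    (A B : Finset (Fin K)) {E : ℕ → Set (∀ k, ℕ → S k)}
    (hE : ∀ n, MeasurableSet[globalSigma S n] (E n)) {a : ℝ}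
    (ha : ∀ n, ∀ ω ∈ E n, sumLogLR P₀ P₁ A n ω + a ≤ sumLogLR P₀ P₁ B n ω) :
    jointLaw P₀ P₁ A (⋃ n, E n) ≤ ENNReal.ofReal (Real.exp (-a)) := by
  -- `disjointed E n` is the event that `E` is first met at index `n`. It is still known at time
  -- `n`, so the change of measure applies to each piece, and the pieces have total `B`-mass at most
  -- one.
  have hd : ∀ n, MeasurableSet[globalSigma S n] (disjointed E n) := fun n => by
    rw [disjointed_eq_inter_compl]
    exact @MeasurableSet.inter _ (globalSigma S n) _ _ (hE n)
      (@MeasurableSet.biInter _ _ (globalSigma S n) _ _ (Set.to_countable {j | j < n})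
        fun m hm => @MeasurableSet.compl _ _ (globalSigma S n)
          (globalSigma_mono (le_of_lt hm) _ (hE m)))
  have hd' : ∀ n, MeasurableSet (disjointed E n) := fun n => globalSigma_le n _ (hd n)
  rw [← iUnion_disjointed, measure_iUnion (disjoint_disjointed E) hd']
  calc ∑' n, jointLaw P₀ P₁ A (disjointed E n)
      ≤ ∑' n, ENNReal.ofReal (Real.exp (-a)) * jointLaw P₀ P₁ B (disjointed E n) :=
        ENNReal.tsum_le_tsum fun n => jointLaw_le_exp_mul (fun k => (hP k).ac₁ n)
          (fun k => (hP k).ac₀ n) A B (hd n) fun ω hω => by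
            linarith [ha n ω (disjointed_subset E n hω)]
    _ = ENNReal.ofReal (Real.exp (-a)) * jointLaw P₀ P₁ B (⋃ n, disjointed E n) := by
        rw [ENNReal.tsum_mul_left, measure_iUnion (disjoint_disjointed E) hd']
    _ ≤ ENNReal.ofReal (Real.exp (-a)) * 1 := by gcongr; exact prob_le_one
    _ = _ := mul_one _

/-- Ville's inequality against `insert k A`. Here and in the next two bounds, the comparison set is
only a reference law and need not have an admissible size. -/
lemma jointLaw_exists_le_logLR (hP : ∀ k, StreamAssumptions (P₀ k) (P₁ k) (I k) (J k))
    {A : Finset (Fin K)} {k : Fin K} (hk : k ∉ A) (a : ℝ) :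
    jointLaw P₀ P₁ A (⋃ n, {ω | a ≤ logLR (P₀ k) (P₁ k) n (ω k)})
      ≤ ENNReal.ofReal (Real.exp (-a)) :=
  jointLaw_iUnion_le hP A (insert k A)
    (fun n => localSigma_le_globalSigma k n _ (measurableSet_le_logLR k n a)) fun n ω hω => by
      have : a ≤ _ := hω
      rw [sumLogLR, sumLogLR, Finset.sum_insert hk]
      linarith

lemma jointLaw_exists_logLR_le (hP : ∀ k, StreamAssumptions (P₀ k) (P₁ k) (I k) (J k))
    {A : Finset (Fin K)} {k : Fin K} (hk : k ∈ A) (a : ℝ) :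
    jointLaw P₀ P₁ A (⋃ n, {ω | logLR (P₀ k) (P₁ k) n (ω k) ≤ -a})
      ≤ ENNReal.ofReal (Real.exp (-a)) :=
  jointLaw_iUnion_le hP A (A.erase k)
    (fun n => localSigma_le_globalSigma k n _ (measurableSet_logLR_le k n (-a))) fun n ω hω => by
      have : _ ≤ -a := hω
      rw [sumLogLR, sumLogLR, ← Finset.add_sum_erase A _ hk]
      linarith

lemma jointLaw_exists_le_logLR_sub (hP : ∀ k, StreamAssumptions (P₀ k) (P₁ k) (I k) (J k))
    {A : Finset (Fin K)} {k j : Fin K} (hk : k ∉ A) (hj : j ∈ A) (a : ℝ) :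
    jointLaw P₀ P₁ A
      (⋃ n, {ω | a ≤ logLR (P₀ k) (P₁ k) n (ω k) - logLR (P₀ j) (P₁ j) n (ω j)})
      ≤ ENNReal.ofReal (Real.exp (-a)) :=
  jointLaw_iUnion_le hP A (insert k (A.erase j))
    (fun n => measurableSet_le_logLR_sub k j n a) fun n ω hω => by
      have : a ≤ _ := hω
      rw [sumLogLR, sumLogLR, ← Finset.add_sum_erase A _ hj,
        Finset.sum_insert fun h => hk (Finset.mem_of_mem_erase h)]
      linarith

lemma tsum_jointLaw_lt_top_of_mem (hP : ∀ k, StreamAssumptions (P₀ k) (P₁ k) (I k) (J k))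
    {A : Finset (Fin K)} {k : Fin K} (hk : k ∈ A) {r : ℝ} (hr : r < I k) :
    ∑' n : ℕ, jointLaw P₀ P₁ A
      {ω | logLR (P₀ k) (P₁ k) (n + 1) (ω k) / (n + 1 : ℕ) ≤ r} < ∞ := by
  have := (hP k).complete₁ (I k - r) (by linarith)
  rw [sub_sub_cancel] at this
  refine (tsum_congr fun n => ?_).trans_lt this
  exact jointLaw_eval_of_mem P₀ P₁ hk
    (measurableSet_le ((measurable_logLR _ _ _).div_const _) measurable_const)

lemma tsum_jointLaw_lt_top_of_notMem (hP : ∀ k, StreamAssumptions (P₀ k) (P₁ k) (I k) (J k))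
    {A : Finset (Fin K)} {k : Fin K} (hk : k ∉ A) {r : ℝ} (hr : r < J k) :
    ∑' n : ℕ, jointLaw P₀ P₁ A
      {ω | -logLR (P₀ k) (P₁ k) (n + 1) (ω k) / (n + 1 : ℕ) ≤ r} < ∞ := by
  have := (hP k).complete₀ (J k - r) (by linarith)
  rw [sub_sub_cancel] at this
  refine (tsum_congr fun n => ?_).trans_lt this
  exact jointLaw_eval_of_notMem P₀ P₁ hk
    (measurableSet_le ((measurable_logLR _ _ _).neg.div_const _) measurable_const)

/-- Whichever law stream `k` follows, its log-likelihood ratio drifts towards one of the two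
thresholds, and half the drift rate already bounds the mean of `T`. -/
lemma ae_lt_top_of_exit (hP : ∀ k, StreamAssumptions (P₀ k) (P₁ k) (I k) (J k))
    (A : Finset (Fin K)) (k : Fin K) {T : (∀ k, ℕ → S k) → ℕ∞} (hTm : Measurable T) {a b : ℝ}
    (ha : ∀ n : ℕ, 1 ≤ n → ∀ ω, a ≤ logLR (P₀ k) (P₁ k) n (ω k) → T ω ≤ n)
    (hb : ∀ n : ℕ, 1 ≤ n → ∀ ω, logLR (P₀ k) (P₁ k) n (ω k) ≤ -b → T ω ≤ n) :
    ∀ᵐ ω ∂(jointLaw P₀ P₁ A), T ω < ⊤ := by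
  have key : ∫⁻ ω, (T ω : ℝ≥0∞) ∂(jointLaw P₀ P₁ A) ≠ ∞ := by
    by_cases hk : k ∈ A
    · have hI := (hP k).I_pos
      obtain ⟨C, hC, h⟩ := exists_lintegral_le_of_exceedance (P := jointLaw P₀ P₁ A)
        (Λ := fun n ω => logLR (P₀ k) (P₁ k) n (ω k)) (fun n => measurable_logLR_eval' k n)
        (half_pos hI) (tsum_jointLaw_lt_top_of_mem hP hk (half_lt_self hI))
      exact ((h a T ha).trans_lt (ENNReal.add_lt_top.2 ⟨ENNReal.ofReal_lt_top, hC⟩)).ne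
    · have hJ := (hP k).J_pos
      obtain ⟨C, hC, h⟩ := exists_lintegral_le_of_exceedance (P := jointLaw P₀ P₁ A)
        (Λ := fun n ω => -logLR (P₀ k) (P₁ k) n (ω k)) (fun n => (measurable_logLR_eval' k n).neg)
        (half_pos hJ) (tsum_jointLaw_lt_top_of_notMem hP hk (half_lt_self hJ))
      exact ((h b T fun n hn ω hω => hb n hn ω (by linarith)).trans_lt
        (ENNReal.add_lt_top.2 ⟨ENNReal.ofReal_lt_top, hC⟩)).ne
  filter_upwards [ae_lt_top ((measurable_of_countable _).comp hTm) key] with ω hω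
  simpa using hω

lemma ofReal_mul_exp_neg_log_div {c α : ℝ} (hc : 0 < c) (hα : 0 < α) :
    ENNReal.ofReal c * ENNReal.ofReal (Real.exp (-(-Real.log α + Real.log c)))
      = ENNReal.ofReal α := by
  rw [← ENNReal.ofReal_mul hc.le, neg_add, neg_neg, Real.exp_add, Real.exp_log hα, Real.exp_neg,
    Real.exp_log hc]
  congr 1
  field_simp

/-- Sufficient conditions for an exit procedure to control the familywise error rates. The
constant in the thresholds is `log (K * (K + 1))`. -/
lemma exitProcedure_mem_controlled
    (hP : ∀ k, StreamAssumptions (P₀ k) (P₁ k) (I k) (J k)) {l u : ℕ} (hK : 0 < K)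
    {α β a b : ℝ} (hα : 0 < α) (hβ : 0 < β)
    (ha : a = -Real.log α + Real.log (K * (K + 1))) (hb : b = -Real.log β + Real.log (K * (K + 1)))
    {U V : Fin K → ℕ → Set (∀ k, ℕ → S k)}
    (hU : ∀ k n, MeasurableSet[globalSigma S n] (U k n))
    (hV : ∀ k n, MeasurableSet[globalSigma S n] (V k n))
    (hVeq : ∀ k n, V k n = {ω | logLR (P₀ k) (P₁ k) n (ω k) ≤ -b})
    (hUsup : ∀ k n ω, a ≤ logLR (P₀ k) (P₁ k) n (ω k) → ω ∈ U k n)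
    (hUsub : ∀ k n, ∀ ω ∈ U k n, a ≤ logLR (P₀ k) (P₁ k) n (ω k) ∨
      ∃ B : Finset (Fin K), k ∉ B ∧ B.card = K - l ∧
        ∀ j ∈ B, a ≤ logLR (P₀ k) (P₁ k) n (ω k) - logLR (P₀ j) (P₁ j) n (ω j)) :
    exitProcedure U V hU hV ∈ controlled P₀ P₁ (boundedClass K l u) α β := by
  intro A hA
  have hT : ∀ k, ∀ᵐ ω ∂(jointLaw P₀ P₁ A), (exitProcedure U V hU hV).T k ω < ⊤ := fun k =>
    ae_lt_top_of_exit hP A k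
      (((exitProcedure U V hU hV).isDecision k).measurable_T globalSigma_le)
      (fun n hn ω hω => firstExit_le hn (Or.inl (hUsup k n ω hω)))
      (fun n hn ω hω => firstExit_le hn (Or.inr (by rw [hVeq]; exact hω)))
  have hKpos : (0 : ℝ) < K * (K + 1) := by positivity
  have hKcast : ENNReal.ofReal ((K : ℝ) * (K + 1)) = (K : ℝ≥0∞) * (K + 1) := by
    rw [ENNReal.ofReal_mul (by positivity), ENNReal.ofReal_add (by positivity) zero_le_one,
      ENNReal.ofReal_natCast, ENNReal.ofReal_one]
  have hcard : ∀ B : Finset (Fin K), B.card ≤ K := fun B =>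
    (Finset.card_le_univ B).trans (Fintype.card_fin K).le
  refine ⟨hT, ?_, ?_⟩
  · have hk : ∀ k ∉ A, jointLaw P₀ P₁ A (⋃ n, U k n)
        ≤ (K + 1) * ENNReal.ofReal (Real.exp (-a)) := fun k hk => by
      have hsub : (⋃ n, U k n) ⊆ (⋃ j ∈ A,
          ⋃ n, {ω | a ≤ logLR (P₀ k) (P₁ k) n (ω k) - logLR (P₀ j) (P₁ j) n (ω j)}) ∪
          ⋃ n, {ω | a ≤ logLR (P₀ k) (P₁ k) n (ω k)} := by
        refine Set.iUnion_subset fun n ω hω => ?_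
        rcases hUsub k n ω hω with h | ⟨B, hkB, hB, h⟩
        · exact Or.inr (Set.mem_iUnion.2 ⟨n, h⟩)
        -- Pigeonhole: if `A` and `B` were disjoint, then together with `k` they would have at least
        -- `l + (K - l) + 1 > K` elements.
        · obtain ⟨j, hjA, hjB⟩ : ∃ j ∈ A, j ∈ B := by
            by_contra! hcon
            have h1 : (insert k (A ∪ B)).card = (A.card + B.card) + 1 := by
              rw [Finset.card_insert_of_notMem (by simp [hk, hkB]),
                Finset.card_union_of_disjoint (Finset.disjoint_left.2 hcon)]
            have h2 := (Finset.card_le_univ (insert k (A ∪ B))).trans (Fintype.card_fin K).le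
            have h3 : l ≤ A.card := hA.1
            omega
          exact Or.inl (Set.mem_biUnion (Finset.mem_coe.2 hjA) (Set.mem_iUnion.2 ⟨n, h j hjB⟩))
      -- At most `K` gaps over signals plus the stream's own threshold give the factor `K + 1`; the
      -- at most `K` noise streams give the other factor `K`.
      refine (measure_mono hsub).trans ((measure_union_le _ _).trans ?_)
      rw [add_mul, one_mul]
      refine add_le_add ?_ (jointLaw_exists_le_logLR hP hk a)
      refine (measure_biUnion_finset_le _ _).trans ?_
      refine (Finset.sum_le_sum fun j hj => jointLaw_exists_le_logLR_sub hP hk hj a).trans ?_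
      rw [Finset.sum_const, nsmul_eq_mul]
      gcongr
      exact hcard A
    have hsub : {ω | ∃ j, j ∉ A ∧ (exitProcedure U V hU hV).D j ω = true}
        ⊆ ⋃ k ∈ Aᶜ, ⋃ n, U k n := by
      rintro ω ⟨j, hj, hD⟩
      obtain ⟨n, -, hn⟩ := exitDecision_eq_true_iff.1 hD
      exact Set.mem_biUnion (Finset.mem_coe.2 (Finset.mem_compl.2 hj)) (Set.mem_iUnion.2 ⟨n, hn⟩)
    calc (exitProcedure U V hU hV).fwe₁ P₀ P₁ A
        ≤ ∑ k ∈ Aᶜ, jointLaw P₀ P₁ A (⋃ n, U k n) :=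
          (measure_mono hsub).trans (measure_biUnion_finset_le _ _)
      _ ≤ ∑ k ∈ Aᶜ, (K + 1) * ENNReal.ofReal (Real.exp (-a)) :=
          Finset.sum_le_sum fun k hkA => hk k (Finset.mem_compl.1 hkA)
      _ ≤ K * ((K + 1) * ENNReal.ofReal (Real.exp (-a))) := by
          rw [Finset.sum_const, nsmul_eq_mul]
          gcongr
          exact hcard _
      _ = ENNReal.ofReal α := by
          rw [← mul_assoc, ← hKcast, ha, ofReal_mul_exp_neg_log_div hKpos hα]
  -- The inclusion holds only almost surely: the default decision `false` on non-terminating paths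
  -- would otherwise count as a missed signal outside every `V k n`.
  · have hle : (exitProcedure U V hU hV).fwe₂ P₀ P₁ A
        ≤ jointLaw P₀ P₁ A (⋃ k ∈ A, ⋃ n, V k n) := by
      refine measure_mono_ae ?_
      filter_upwards [ae_all_iff.2 hT] with ω hω ⟨i, hi, hD⟩
      exact Set.mem_biUnion (Finset.mem_coe.2 hi) (mem_iUnion_of_exitDecision_false (hω i) hD)
    calc (exitProcedure U V hU hV).fwe₂ P₀ P₁ A
        ≤ ∑ k ∈ A, jointLaw P₀ P₁ A (⋃ n, V k n) :=
          hle.trans (measure_biUnion_finset_le _ _)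
      _ ≤ ∑ k ∈ A, ENNReal.ofReal (Real.exp (-b)) :=
          Finset.sum_le_sum fun k hk => by
            simp only [hVeq]
            exact jointLaw_exists_logLR_le hP hk b
      _ ≤ K * ENNReal.ofReal (Real.exp (-b)) := by
          rw [Finset.sum_const, nsmul_eq_mul]
          gcongr
          exact hcard _
      -- The factor `K` would suffice here; the larger one lets both thresholds share a constant.
      _ ≤ K * (K + 1) * ENNReal.ofReal (Real.exp (-b)) := by
          gcongr
          exact le_mul_of_one_le_right' le_add_self
      _ = ENNReal.ofReal β := by
          rw [← hKcast, hb, ofReal_mul_exp_neg_log_div hKpos hβ]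

end ExitProcedure

/-! ### First-order asymptotics of the optimal times for signals -/

section Rates

variable {K : ℕ} {S : Fin K → Type*} [∀ k, MeasurableSpace (S k)]
    {P₀ P₁ : ∀ k, Measure (ℕ → S k)}

lemma optTime_le_optTimeDec (Pr : Set (Finset (Fin K))) (k : Fin K) (A : Finset (Fin K))
    (α β : ℝ) : optTime P₀ P₁ Pr k A α β ≤ optTimeDec P₀ P₁ Pr k A α β :=
  biInf_mono fun _ hχ => hχ.2

variable [∀ k, IsProbabilityMeasure (P₀ k)] [∀ k, IsProbabilityMeasure (P₁ k)]
    {I J : Fin K → ℝ} {l u : ℕ}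

lemma ae_eventually_logLR_le_of_mem (hP : ∀ k, StreamAssumptions (P₀ k) (P₁ k) (I k) (J k))
    {A : Finset (Fin K)} {i : Fin K} (hi : i ∈ A) :
    ∀ᵐ ω ∂(jointLaw P₀ P₁ A), ∀ ε : ℝ, 0 < ε → ∀ᶠ n : ℕ in atTop,
      logLR (P₀ i) (P₁ i) n (ω i) ≤ (I i + ε) * n :=
  ae_jointLaw_of_mem P₀ P₁ hi (eventually_logLR_le (hP i))

lemma ae_eventually_neg_logLR_le_of_notMem
    (hP : ∀ k, StreamAssumptions (P₀ k) (P₁ k) (I k) (J k))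
    {A : Finset (Fin K)} {j : Fin K} (hj : j ∉ A) :
    ∀ᵐ ω ∂(jointLaw P₀ P₁ A), ∀ ε : ℝ, 0 < ε → ∀ᶠ n : ℕ in atTop,
      -logLR (P₀ j) (P₁ j) n (ω j) ≤ (J j + ε) * n := by
  filter_upwards [ae_jointLaw_of_notMem P₀ P₁ hj (eventually_logLR_le (hP j).swap),
    ae_jointLaw_of_notMem P₀ P₁ hj (ae_all_iff.2 fun n => logLR_swap_ae' ((hP j).ac₀ n))]
    with ω h1 h2 ε hε
  simpa only [h2] using h1 ε hε

/-- Lower bound on the optimal expected time to detect the signal `i`, by comparison with a set of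
signals `B` that does not contain `i`. -/
lemma eventually_le_optTime (hP : ∀ k, StreamAssumptions (P₀ k) (P₁ k) (I k) (J k))
    {A B : Finset (Fin K)} {i : Fin K} (hiA : i ∈ A) (hiB : i ∉ B) {Pr : Set (Finset (Fin K))}
    (hA : A ∈ Pr) (hB : B ∈ Pr) {R : ℝ} (hR : 0 < R)
    (hΛ : ∀ᵐ ω ∂(jointLaw P₀ P₁ A), ∀ ε : ℝ, 0 < ε → ∀ᶠ n : ℕ in atTop,
      sumLogLR P₀ P₁ A n ω - sumLogLR P₀ P₁ B n ω ≤ (R + ε) * n) {r : ℝ} (hr : r < 1 / R) :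
    ∀ᶠ p : ℝ × ℝ in 𝓝[>] 0 ×ˢ 𝓝[>] 0,
      ENNReal.ofReal (r * -Real.log p.1) ≤ optTime P₀ P₁ Pr i A p.1 p.2 := by
  have key := eventually_le_lintegral_decision (F := globalSigma S) globalSigma_le
    (P := jointLaw P₀ P₁ A) (Q := jointLaw P₀ P₁ B)
    (Λ := fun n ω => sumLogLR P₀ P₁ A n ω - sumLogLR P₀ P₁ B n ω)
    (fun n => Measurable.fun_sub (m := globalSigma S n) (measurable_sumLogLR P₀ P₁ A n)
      (measurable_sumLogLR P₀ P₁ B n)) hR hΛ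
    (fun n c E hE hc => jointLaw_le_exp_mul (fun k => (hP k).ac₁ n) (fun k => (hP k).ac₀ n) A B hE
      fun ω hω => by linarith [hc ω hω]) hr
  filter_upwards [key] with p hp
  refine le_iInf₂ fun χ hχ => ?_
  refine hp (χ.T i) (χ.D i) (χ.isDecision i) ?_ ?_
  · exact (measure_mono fun _ hω => Exists.intro i ⟨hiB, hω⟩).trans (hχ B hB).2.1
  · exact (measure_mono fun _ hω => Exists.intro i ⟨hiA, hω⟩).trans (hχ A hA).2.2

lemma eventually_le_optTimeDec (hP : ∀ k, StreamAssumptions (P₀ k) (P₁ k) (I k) (J k))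
    {A B : Finset (Fin K)} {i : Fin K} (hiA : i ∈ A) (hiB : i ∉ B) {Pr : Set (Finset (Fin K))}
    (hA : A ∈ Pr) (hB : B ∈ Pr) {r : ℝ} (hr : r < 1 / I i) :
    ∀ᶠ p : ℝ × ℝ in 𝓝[>] 0 ×ˢ 𝓝[>] 0,
      ENNReal.ofReal (r * -Real.log p.1) ≤ optTimeDec P₀ P₁ Pr i A p.1 p.2 := by
  have key := eventually_le_lintegral_decision (F := localSigma S i) (localSigma_le i)
    (P := jointLaw P₀ P₁ A) (Q := jointLaw P₀ P₁ B)
    (Λ := fun n ω => logLR (P₀ i) (P₁ i) n (ω i))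
    (fun n => measurable_logLR_eval P₀ P₁ i n) (hP i).I_pos (ae_eventually_logLR_le_of_mem hP hiA)
    (fun n c E hE hc => jointLaw_le_exp_mul_local (fun k => (hP k).ac₁ n) (fun k => (hP k).ac₀ n)
      hiA hiB hE hc) hr
  filter_upwards [key] with p hp
  refine le_iInf₂ fun χ hχ => ?_
  refine hp (χ.T i) (χ.D i) (hχ.1 i) ?_ ?_
  · exact (measure_mono fun _ hω => Exists.intro i ⟨hiB, hω⟩).trans (hχ.2 B hB).2.1
  · exact (measure_mono fun _ hω => Exists.intro i ⟨hiA, hω⟩).trans (hχ.2 A hA).2.2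

/-- Parallel sequential probability ratio tests give an upper bound on `optTimeDec`. -/
lemma exists_optTimeDec_le (hP : ∀ k, StreamAssumptions (P₀ k) (P₁ k) (I k) (J k)) (hK : 0 < K)
    {A : Finset (Fin K)} {i : Fin K} (hi : i ∈ A) {r : ℝ} (hr : 0 < r) (hrI : r < I i) :
    ∃ (c : ℝ) (C : ℝ≥0∞), C < ∞ ∧ ∀ᶠ p : ℝ × ℝ in 𝓝[>] 0 ×ˢ 𝓝[>] 0,
      optTimeDec P₀ P₁ (boundedClass K l u) i A p.1 p.2
        ≤ ENNReal.ofReal ((-Real.log p.1 + c) / r) + C := by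
  obtain ⟨C, hC, h⟩ := exists_lintegral_le_of_exceedance (P := jointLaw P₀ P₁ A)
    (Λ := fun n ω => logLR (P₀ i) (P₁ i) n (ω i)) (fun n => measurable_logLR_eval' i n)
    hr (tsum_jointLaw_lt_top_of_mem hP hi hrI)
  refine ⟨Real.log (K * (K + 1)), C, hC, ?_⟩
  filter_upwards [tendsto_fst.eventually (eventually_mem_nhdsWithin),
    tendsto_snd.eventually (eventually_mem_nhdsWithin)] with p hα hβ
  set a : ℝ := -Real.log p.1 + Real.log (K * (K + 1)) with ha
  set b : ℝ := -Real.log p.2 + Real.log (K * (K + 1)) with hb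
  set U : Fin K → ℕ → Set (∀ k, ℕ → S k) :=
    fun k n => {ω | a ≤ logLR (P₀ k) (P₁ k) n (ω k)} with hU
  set V : Fin K → ℕ → Set (∀ k, ℕ → S k) :=
    fun k n => {ω | logLR (P₀ k) (P₁ k) n (ω k) ≤ -b} with hV
  have hUm : ∀ k n, MeasurableSet[localSigma S k n] (U k n) :=
    fun k n => measurableSet_le_logLR k n a
  have hVm : ∀ k n, MeasurableSet[localSigma S k n] (V k n) :=
    fun k n => measurableSet_logLR_le k n (-b)
  have hmem := exitProcedure_mem_controlled hP (l := l) (u := u) hK hα hβ ha hb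
    (fun k n => localSigma_le_globalSigma k n _ (hUm k n))
    (fun k n => localSigma_le_globalSigma k n _ (hVm k n)) (fun _ _ => rfl) (fun _ _ _ h => h)
    (fun _ _ _ h => Or.inl h)
  refine (iInf₂_le (exitProcedure U V _ _) ⟨fun k => ?_, hmem⟩).trans
    (h a (firstExit (U i) (V i)) fun n hn ω hω => firstExit_le hn (Or.inl hω))
  exact isDecision_firstExit (localSigma_mono k) (localSigma_le k) (hUm k) (hVm k)

/-- When `A` has the smallest possible size, gaps between log-likelihood ratios can be used to
detect the signals. -/
lemma exists_optTime_le (hP : ∀ k, StreamAssumptions (P₀ k) (P₁ k) (I k) (J k)) (hK : 0 < K)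
    {A : Finset (Fin K)} (hA : A.card = l) {i : Fin K} (hi : i ∈ A) {j₀ : Fin K} (hj₀ : j₀ ∉ A)
    (hmin : ∀ j ∉ A, J j₀ ≤ J j) {r : ℝ} (hr : 0 < r) (hrI : r < I i + J j₀) :
    ∃ (c : ℝ) (C : ℝ≥0∞), C < ∞ ∧ ∀ᶠ p : ℝ × ℝ in 𝓝[>] 0 ×ˢ 𝓝[>] 0,
      optTime P₀ P₁ (boundedClass K l u) i A p.1 p.2
        ≤ ENNReal.ofReal ((-Real.log p.1 + c) / r) + C := by
  have hne : Aᶜ.Nonempty := ⟨j₀, Finset.mem_compl.2 hj₀⟩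
  set Λ : ℕ → (∀ k, ℕ → S k) → ℝ := fun n ω => Aᶜ.inf' hne fun j =>
    logLR (P₀ i) (P₁ i) n (ω i) - logLR (P₀ j) (P₁ j) n (ω j) with hΛ
  have hΛm : ∀ n, Measurable (Λ n) := fun n => by
    have : Measurable (Aᶜ.inf' hne fun j (ω : ∀ k, ℕ → S k) =>
        logLR (P₀ i) (P₁ i) n (ω i) - logLR (P₀ j) (P₁ j) n (ω j)) :=
      Finset.inf'_induction hne _ (fun _ hf _ hg => hf.inf hg) fun j _ =>
        (measurable_logLR_eval' i n).sub (measurable_logLR_eval' j n)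
    convert this using 1
    ext ω
    simp [hΛ, Finset.inf'_apply]
  -- Half the slack for each stream: since `r ≤ (I i - δ) + (J j - δ)` for every noise `j`, a
  -- smallest gap of at most `r * n` means that stream `i` or the minimizing `j` is slow by `δ`.
  set δ : ℝ := (I i + J j₀ - r) / 2 with hδ
  have hδ0 : 0 < δ := by rw [hδ]; linarith
  have hsum : ∑' n : ℕ, jointLaw P₀ P₁ A {ω | Λ (n + 1) ω / (n + 1 : ℕ) ≤ r} < ∞ := by
    have h1 := tsum_jointLaw_lt_top_of_mem hP hi (sub_lt_self (I i) hδ0)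
    have h2 : ∀ j ∈ Aᶜ, ∑' n : ℕ, jointLaw P₀ P₁ A
        {ω | -logLR (P₀ j) (P₁ j) (n + 1) (ω j) / (n + 1 : ℕ) ≤ J j - δ} < ∞ := fun j hj =>
      tsum_jointLaw_lt_top_of_notMem hP (Finset.mem_compl.1 hj) (sub_lt_self (J j) hδ0)
    refine lt_of_le_of_lt ?_ (ENNReal.add_lt_top.2 ⟨h1, ENNReal.sum_lt_top.2 h2⟩)
    rw [← Summable.tsum_finsetSum fun _ _ => ENNReal.summable, ← ENNReal.tsum_add]
    refine ENNReal.tsum_le_tsum fun n => ?_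
    refine le_trans (measure_mono ?_) ((measure_union_le _ _).trans
      (add_le_add le_rfl (measure_biUnion_finset_le _ _)))
    intro ω hω
    obtain ⟨j, hj, hjeq⟩ := Finset.exists_mem_eq_inf' hne fun j =>
      logLR (P₀ i) (P₁ i) (n + 1) (ω i) - logLR (P₀ j) (P₁ j) (n + 1) (ω j)
    have hω' : Λ (n + 1) ω / (n + 1 : ℕ) ≤ r := hω
    rw [hΛ] at hω'
    simp only [hjeq] at hω'
    by_cases h : logLR (P₀ i) (P₁ i) (n + 1) (ω i) / (n + 1 : ℕ) ≤ I i - δ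
    · exact Or.inl h
    · refine Or.inr (Set.mem_biUnion (Finset.mem_coe.2 hj) ?_)
      change -logLR (P₀ j) (P₁ j) (n + 1) (ω j) / (n + 1 : ℕ) ≤ J j - δ
      rw [sub_div] at hω'
      rw [neg_div]
      have := hmin j (Finset.mem_compl.1 hj)
      linarith
  obtain ⟨C, hC, h⟩ := exists_lintegral_le_of_exceedance (P := jointLaw P₀ P₁ A) hΛm hr hsum
  refine ⟨Real.log (K * (K + 1)), C, hC, ?_⟩
  filter_upwards [tendsto_fst.eventually (eventually_mem_nhdsWithin),
    tendsto_snd.eventually (eventually_mem_nhdsWithin)] with p hα hβ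
  set a : ℝ := -Real.log p.1 + Real.log (K * (K + 1)) with ha
  set b : ℝ := -Real.log p.2 + Real.log (K * (K + 1)) with hb
  -- The stream's own threshold stays in the rule to ensure termination under every other set of the
  -- class, where the gap condition may never be met.
  set U : Fin K → ℕ → Set (∀ k, ℕ → S k) :=
    fun k n => {ω | a ≤ logLR (P₀ k) (P₁ k) n (ω k)} ∪
      ⋃ B ∈ {B : Finset (Fin K) | k ∉ B ∧ B.card = K - l}, ⋂ j ∈ B,
        {ω | a ≤ logLR (P₀ k) (P₁ k) n (ω k) - logLR (P₀ j) (P₁ j) n (ω j)} with hU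
  set V : Fin K → ℕ → Set (∀ k, ℕ → S k) :=
    fun k n => {ω | logLR (P₀ k) (P₁ k) n (ω k) ≤ -b} with hV
  have hUm : ∀ k n, MeasurableSet[globalSigma S n] (U k n) := fun k n =>
    @MeasurableSet.union _ (globalSigma S n) _ _
      (localSigma_le_globalSigma k n _ (measurableSet_le_logLR k n a))
      (@MeasurableSet.biUnion _ _ (globalSigma S n) _ _ (Set.to_countable _) fun B _ =>
        @Finset.measurableSet_biInter _ _ (globalSigma S n) _ B fun j _ =>
          measurableSet_le_logLR_sub k j n a)
  have hVm : ∀ k n, MeasurableSet[globalSigma S n] (V k n) :=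
    fun k n => localSigma_le_globalSigma k n _ (measurableSet_logLR_le k n (-b))
  have hmem := exitProcedure_mem_controlled hP (l := l) (u := u) hK hα hβ ha hb hUm hVm
    (fun _ _ => rfl) (fun _ _ _ h => Or.inl h) (fun k n ω hω => by
      rcases hω with hω | hω
      · exact Or.inl hω
      · obtain ⟨B, hB, hω⟩ := Set.mem_iUnion₂.1 hω
        exact Or.inr ⟨B, hB.1, hB.2, fun j hj => Set.mem_iInter₂.1 hω j hj⟩)
  refine (iInf₂_le (exitProcedure U V hUm hVm) hmem).trans
    (h a (firstExit (U i) (V i)) fun n hn ω hω => firstExit_le hn (Or.inl (Or.inr ?_)))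
  -- Since `|A| = l`, the complement has exactly the required size `K - l`, and `Λ` is the smallest
  -- gap over it.
  refine Set.mem_biUnion (x := Aᶜ) ⟨by simpa using hi, ?_⟩ (Set.mem_iInter₂.2 fun j hj => ?_)
  · rw [Finset.card_compl, Fintype.card_fin, hA]
  · exact hω.trans (Finset.inf'_le _ hj)

/-- As `l < K`, some set of size `l` omits `i`. The local change of measure accepts any such set, so
the rate does not depend on `|A|`. -/
lemma tendsto_optTimeDec (hP : ∀ k, StreamAssumptions (P₀ k) (P₁ k) (I k) (J k))
    (hlu : l ≤ u) (hl : l < K) {A : Finset (Fin K)} (hA : A ∈ boundedClass K l u) {i : Fin K}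
    (hi : i ∈ A) :
    Tendsto (fun p : ℝ × ℝ => optTimeDec P₀ P₁ (boundedClass K l u) i A p.1 p.2 /
      ENNReal.ofReal (-Real.log p.1)) (𝓝[>] 0 ×ˢ 𝓝[>] 0) (𝓝 (ENNReal.ofReal (1 / I i))) := by
  obtain ⟨B, hBi, hB⟩ : ∃ B ⊆ Finset.univ.erase i, B.card = l := by
    refine Finset.exists_subset_card_eq ?_
    rw [Finset.card_erase_of_mem (Finset.mem_univ i), Finset.card_univ, Fintype.card_fin]
    omega
  exact tendsto_div_neg_log (hP i).I_pos
    (fun r hr => eventually_le_optTimeDec hP hi (fun h => Finset.notMem_erase i _ (hBi h)) hA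
      ⟨hB.ge, hB.le.trans hlu⟩ hr)
    (fun r hr hrI => exists_optTimeDec_le hP (by omega) hi hr hrI)

/-- Here `A.erase i` is still admissible, so the general lower bound already meets the decentralized
upper bound. -/
lemma tendsto_optTime_of_card_ne (hP : ∀ k, StreamAssumptions (P₀ k) (P₁ k) (I k) (J k))
    {A : Finset (Fin K)} (hA : A ∈ boundedClass K l u) (hAl : A.card ≠ l)
    {i : Fin K} (hi : i ∈ A) :
    Tendsto (fun p : ℝ × ℝ => optTime P₀ P₁ (boundedClass K l u) i A p.1 p.2 /
      ENNReal.ofReal (-Real.log p.1)) (𝓝[>] 0 ×ˢ 𝓝[>] 0) (𝓝 (ENNReal.ofReal (1 / I i))) := by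
  have hcard : (A.erase i).card = A.card - 1 := Finset.card_erase_of_mem hi
  have hA1 : l ≤ A.card := hA.1
  have hA2 : A.card ≤ u := hA.2
  refine tendsto_div_neg_log (hP i).I_pos
    (fun r hr => eventually_le_optTime hP hi (Finset.notMem_erase i A) hA
      ⟨by omega, by omega⟩ (hP i).I_pos ?_ hr)
    (fun r hr hrI => ?_)
  · filter_upwards [ae_eventually_logLR_le_of_mem hP hi] with ω hω ε hε
    filter_upwards [hω ε hε] with n hn
    rw [sumLogLR, sumLogLR, ← Finset.add_sum_erase A _ hi]
    linarith
  · obtain ⟨c, C, hC, h⟩ := exists_optTimeDec_le (l := l) (u := u) hP i.pos hi hr hrI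
    exact ⟨c, C, hC, h.mono fun p hp => (optTime_le_optTimeDec _ _ _ _ _).trans hp⟩

/-- Removing `i` would leave the class, so the competitor exchanges `i` for `j₀`. The minimality of
`J j₀` serves the upper bound, where the slowest gap decides. -/
lemma tendsto_optTime_of_card_eq (hP : ∀ k, StreamAssumptions (P₀ k) (P₁ k) (I k) (J k))
    {A : Finset (Fin K)} (hA : A ∈ boundedClass K l u) (hAl : A.card = l)
    {i : Fin K} (hi : i ∈ A) {j₀ : Fin K} (hj₀ : j₀ ∉ A) (hmin : ∀ j ∉ A, J j₀ ≤ J j) :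
    Tendsto (fun p : ℝ × ℝ => optTime P₀ P₁ (boundedClass K l u) i A p.1 p.2 /
      ENNReal.ofReal (-Real.log p.1)) (𝓝[>] 0 ×ˢ 𝓝[>] 0)
      (𝓝 (ENNReal.ofReal (1 / (I i + J j₀)))) := by
  have hIJ : 0 < I i + J j₀ := add_pos (hP i).I_pos (hP j₀).J_pos
  have hj₀' : j₀ ∉ A.erase i := fun h => hj₀ (Finset.mem_of_mem_erase h)
  have hij : i ≠ j₀ := fun h => hj₀ (h ▸ hi)
  have hcard : (insert j₀ (A.erase i)).card = A.card := by
    rw [Finset.card_insert_of_notMem hj₀', Finset.card_erase_add_one hi]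
  refine tendsto_div_neg_log hIJ
    (fun r hr => eventually_le_optTime hP hi (B := insert j₀ (A.erase i)) (by simp [hij]) hA
      ⟨hcard ▸ hA.1, hcard ▸ hA.2⟩ hIJ ?_ hr)
    (fun r hr hrI => exists_optTime_le hP i.pos hAl hi hj₀ hmin hr hrI)
  filter_upwards [ae_eventually_logLR_le_of_mem hP hi,
    ae_eventually_neg_logLR_le_of_notMem hP hj₀] with ω hω hω' ε hε
  filter_upwards [hω _ (half_pos hε), hω' _ (half_pos hε)] with n hn hn'
  rw [sumLogLR, sumLogLR, ← Finset.add_sum_erase A _ hi, Finset.sum_insert hj₀']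
  linarith

lemma exists_minRate_eq (r : Fin K → ℝ) {B : Finset (Fin K)}
    (hB : B.Nonempty) :
    ∃ j ∈ B, minRate r B = ENNReal.ofReal (r j) ∧ ∀ k ∈ B, r j ≤ r k := by
  obtain ⟨j, hj, hmin⟩ := B.exists_min_image r hB
  refine ⟨j, hj, le_antisymm (Finset.inf_le hj) (Finset.le_inf fun k hk => ?_), hmin⟩
  exact ENNReal.ofReal_le_ofReal (hmin k hk)

lemma tendsto_div_of_tendsto_div {f g : ℝ × ℝ → ℝ≥0∞} {a b : ℝ} (ha : 0 < a) (hb : 0 < b)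
    (hf : Tendsto (fun p => f p / ENNReal.ofReal (-Real.log p.1)) (𝓝[>] 0 ×ˢ 𝓝[>] 0)
      (𝓝 (ENNReal.ofReal a)))
    (hg : Tendsto (fun p => g p / ENNReal.ofReal (-Real.log p.1)) (𝓝[>] 0 ×ˢ 𝓝[>] 0)
      (𝓝 (ENNReal.ofReal b))) :
    Tendsto (fun p => f p / g p) (𝓝[>] 0 ×ˢ 𝓝[>] 0) (𝓝 (ENNReal.ofReal (a / b))) := by
  rw [ENNReal.ofReal_div_of_pos hb]
  refine (ENNReal.Tendsto.div hf (Or.inl (ENNReal.ofReal_pos.2 ha).ne') hg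
    (Or.inl ENNReal.ofReal_ne_top)).congr' ?_
  filter_upwards [tendsto_neg_log_fst_atTop.eventually_gt_atTop 0] with p hp
  have h0 := (ENNReal.ofReal_pos.2 hp).ne'
  rw [div_eq_mul_inv, div_eq_mul_inv, div_eq_mul_inv, div_eq_mul_inv,
    ENNReal.mul_inv (Or.inr (ENNReal.inv_ne_top.2 h0))
      (Or.inr (ENNReal.inv_ne_zero.2 ENNReal.ofReal_ne_top)), inv_inv, mul_mul_mul_comm,
    ENNReal.inv_mul_cancel h0 ENNReal.ofReal_ne_top, mul_one]

/-- The asymptotic relative efficiency of decentralized procedures for the detection of a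
signal. -/
theorem hasAREDec_of_mem (hP : ∀ k, StreamAssumptions (P₀ k) (P₁ k) (I k) (J k))
    (hlu : l ≤ u) (hl : l < K) {A : Finset (Fin K)} (hA : A ∈ boundedClass K l u) {i : Fin K}
    (hi : i ∈ A) :
    HasAREDec P₀ P₁ l u i A
      (if A.card = l then ENNReal.ofReal (I i) / (ENNReal.ofReal (I i) + minRate J Aᶜ) else 1) := by
  have hI := (hP i).I_pos
  have hdec := tendsto_optTimeDec hP hlu hl hA hi
  split_ifs with hAl
  · have hne : Aᶜ.Nonempty := by
      rw [← Finset.card_pos, Finset.card_compl, Fintype.card_fin]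
      omega
    obtain ⟨j₀, hj₀, hrate, hmin⟩ := exists_minRate_eq J hne
    have hJ := (hP j₀).J_pos
    have := tendsto_div_of_tendsto_div (by positivity) (by positivity)
      (tendsto_optTime_of_card_eq hP hA hAl hi (Finset.mem_compl.1 hj₀)
        fun j hj => hmin j (Finset.mem_compl.2 hj)) hdec
    rw [hrate, ← ENNReal.ofReal_add hI.le hJ.le, ← ENNReal.ofReal_div_of_pos (by positivity)]
    have heq : 1 / (I i + J j₀) / (1 / I i) = I i / (I i + J j₀) := by field_simp
    rwa [heq] at this
  · have := tendsto_div_of_tendsto_div (by positivity) (by positivity)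
      (tendsto_optTime_of_card_ne hP hA hAl hi) hdec
    rw [div_self (by positivity), ENNReal.ofReal_one] at this
    exact this

end Rates

/-! ### Exchanging signals and noise -/

section Symmetry

variable {K : ℕ} {S : Fin K → Type*} [∀ k, MeasurableSpace (S k)]

lemma IsDecision.not {Ω : Type*} [MeasurableSpace Ω] {F : ℕ → MeasurableSpace Ω}
    {T : Ω → ℕ∞} {D : Ω → Bool} (h : IsDecision F T D) : IsDecision F T fun ω => !D ω where
  one_le := h.one_le
  measurable_D := (measurable_of_countable Bool.not).comp h.measurable_D
  time := h.time
  decision := fun n i => by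
    have := h.decision n (!i)
    simpa only [Bool.not_eq_eq_eq_not] using this

/-- The procedure with the opposite decisions. -/
def Procedure.not (χ : Procedure S) : Procedure S where
  T := χ.T
  D := fun k ω => !χ.D k ω
  isDecision := fun k => (χ.isDecision k).not

variable (P₀ P₁ : ∀ k, Measure (ℕ → S k))

lemma jointLaw_swap (A : Finset (Fin K)) : jointLaw P₁ P₀ A = jointLaw P₀ P₁ Aᶜ := by
  unfold jointLaw
  congr 1
  funext k
  by_cases hk : k ∈ A <;> simp [hk]

variable {P₀ P₁}

lemma Procedure.not_mem_controlled {χ : Procedure S} {Pr : Set (Finset (Fin K))} {α β : ℝ}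
    (h : χ ∈ controlled P₀ P₁ Pr α β) : χ.not ∈ controlled P₁ P₀ {A | Aᶜ ∈ Pr} β α := by
  intro A hA
  obtain ⟨h1, h2, h3⟩ := h Aᶜ hA
  refine ⟨fun k => ?_, ?_, ?_⟩
  · rw [jointLaw_swap]; exact h1 k
  · refine le_of_eq_of_le ?_ h3
    rw [Procedure.fwe₁, Procedure.fwe₂, jointLaw_swap]
    simp [Procedure.not]
  · refine le_of_eq_of_le ?_ h2
    rw [Procedure.fwe₁, Procedure.fwe₂, jointLaw_swap]
    simp [Procedure.not]

lemma Procedure.expTime_not (χ : Procedure S) (k : Fin K) (A : Finset (Fin K)) :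
    χ.not.expTime P₁ P₀ k Aᶜ = χ.expTime P₀ P₁ k A := by
  rw [Procedure.expTime, Procedure.expTime, jointLaw_swap, compl_compl]
  rfl

lemma optTime_swap_le (Pr : Set (Finset (Fin K))) (k : Fin K) (A : Finset (Fin K)) (α β : ℝ) :
    optTime P₁ P₀ {A | Aᶜ ∈ Pr} k Aᶜ β α ≤ optTime P₀ P₁ Pr k A α β :=
  le_iInf₂ fun χ hχ => (iInf₂_le χ.not (Procedure.not_mem_controlled hχ)).trans
    (χ.expTime_not k A).le

lemma optTimeDec_swap_le (Pr : Set (Finset (Fin K))) (k : Fin K) (A : Finset (Fin K))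
    (α β : ℝ) :
    optTimeDec P₁ P₀ {A | Aᶜ ∈ Pr} k Aᶜ β α ≤ optTimeDec P₀ P₁ Pr k A α β :=
  le_iInf₂ fun χ hχ => (iInf₂_le χ.not
    ⟨fun k => (hχ.1 k).not, Procedure.not_mem_controlled hχ.2⟩).trans (χ.expTime_not k A).le

/-- The exchange is an involution, so applying the one-sided inequality twice gives equality. -/
lemma optTime_swap (Pr : Set (Finset (Fin K))) (k : Fin K) (A : Finset (Fin K)) (α β : ℝ) :
    optTime P₁ P₀ {A | Aᶜ ∈ Pr} k Aᶜ β α = optTime P₀ P₁ Pr k A α β := by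
  refine le_antisymm (optTime_swap_le Pr k A α β) ?_
  simpa using optTime_swap_le (P₀ := P₁) (P₁ := P₀) {A | Aᶜ ∈ Pr} k Aᶜ β α

lemma optTimeDec_swap (Pr : Set (Finset (Fin K))) (k : Fin K) (A : Finset (Fin K)) (α β : ℝ) :
    optTimeDec P₁ P₀ {A | Aᶜ ∈ Pr} k Aᶜ β α = optTimeDec P₀ P₁ Pr k A α β := by
  refine le_antisymm (optTimeDec_swap_le Pr k A α β) ?_
  simpa using optTimeDec_swap_le (P₀ := P₁) (P₁ := P₀) {A | Aᶜ ∈ Pr} k Aᶜ β α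

lemma compl_boundedClass {l u : ℕ} (hlu : l ≤ u) (huK : u ≤ K) :
    {A | Aᶜ ∈ boundedClass K l u} = boundedClass K (K - u) (K - l) := by
  ext A
  have h : A.card ≤ K := (Finset.card_le_univ A).trans (Fintype.card_fin K).le
  change (l ≤ Aᶜ.card ∧ Aᶜ.card ≤ u) ↔ (K - u ≤ A.card ∧ A.card ≤ K - l)
  rw [Finset.card_compl, Fintype.card_fin]
  omega

/-- The limit is joint and unrestricted in the two levels, so its filter is invariant under
exchanging `α` and `β`. -/
lemma HasAREDec.swap {l u : ℕ} (hlu : l ≤ u) (huK : u ≤ K) {k : Fin K} {A : Finset (Fin K)}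
    {r : ℝ≥0∞} (h : HasAREDec P₁ P₀ (K - u) (K - l) k Aᶜ r) : HasAREDec P₀ P₁ l u k A r := by
  have := h.comp (tendsto_snd.prodMk tendsto_fst :
    Tendsto (fun p : ℝ × ℝ => (p.2, p.1)) (𝓝[>] 0 ×ˢ 𝓝[>] 0) (𝓝[>] 0 ×ˢ 𝓝[>] 0))
  refine this.congr fun p => ?_
  simp only [Function.comp, ← compl_boundedClass hlu huK, optTime_swap, optTimeDec_swap]

end Symmetry

end SeqTest

open SeqTest in
theorem corollary4p1 {K : ℕ} {S : Fin K → Type*} [∀ k, MeasurableSpace (S k)]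
    (P₀ P₁ : ∀ k, Measure (ℕ → S k))
    [∀ k, IsProbabilityMeasure (P₀ k)] [∀ k, IsProbabilityMeasure (P₁ k)]
    (I J : Fin K → ℝ) (hP : ∀ k, StreamAssumptions (P₀ k) (P₁ k) (I k) (J k))
    (l u : ℕ) (hlu : l ≤ u) (huK : u ≤ K) (hu : 0 < u) (hl : l < K)
    (A : Finset (Fin K)) (hA : A ∈ boundedClass K l u) :
    (∀ i ∈ A, HasAREDec P₀ P₁ l u i A
      (if A.card = l then ENNReal.ofReal (I i) / (ENNReal.ofReal (I i) + minRate J Aᶜ) else 1)) ∧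
    (∀ j ∉ A, HasAREDec P₀ P₁ l u j A
      (if A.card = u then ENNReal.ofReal (J j) / (ENNReal.ofReal (J j) + minRate I A) else 1)) ∧
    (l = 0 → ∀ i ∈ A, HasAREDec P₀ P₁ l u i A 1) ∧
    (u = K → ∀ j ∉ A, HasAREDec P₀ P₁ l u j A 1) := by
  have hmem : ∀ i ∈ A, HasAREDec P₀ P₁ l u i A
      (if A.card = l then ENNReal.ofReal (I i) / (ENNReal.ofReal (I i) + minRate J Aᶜ) else 1) :=
    fun i hi => hasAREDec_of_mem hP hlu hl hA hi
  have hcard : Aᶜ.card = K - A.card := by rw [Finset.card_compl, Fintype.card_fin]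
  have hAK : A.card ≤ K := (Finset.card_le_univ A).trans (Fintype.card_fin K).le
  have hnotMem : ∀ j ∉ A, HasAREDec P₀ P₁ l u j A
      (if A.card = u then ENNReal.ofReal (J j) / (ENNReal.ofReal (J j) + minRate I A) else 1) := by
    intro j hj
    refine HasAREDec.swap hlu huK ?_
    have hA' : Aᶜ ∈ boundedClass K (K - u) (K - l) := by
      rw [← compl_boundedClass hlu huK]
      change Aᶜᶜ ∈ boundedClass K l u
      rwa [compl_compl]
    -- The complementary class has lower bound `K - u`, which must be less than `K`; this is where
    -- `0 < u` enters.
    have := hasAREDec_of_mem (fun k => (hP k).swap) (by omega) (by omega) hA'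
      (Finset.mem_compl.2 hj)
    have hiff : Aᶜ.card = K - u ↔ A.card = u := by omega
    simpa only [hiff, compl_compl] using this
  refine ⟨hmem, hnotMem, fun hl0 i hi => ?_, fun huK' j hj => ?_⟩
  · have := hmem i hi
    rwa [if_neg (by rw [hl0]; exact (Finset.card_pos.2 ⟨i, hi⟩).ne')] at this
  · have := hnotMem j hj
    have hpos : 0 < Aᶜ.card := Finset.card_pos.2 ⟨j, Finset.mem_compl.2 hj⟩
    rwa [if_neg (by omega)] at this
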